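/- Let $N,L,p,q\ge 0$ be integers with $p+q=N+L$, and let $E=\mathbb R^{p,q}$ be the $(N+L)$-dimensional pseudo-Euclidean space of signature $(p,q)$ (scalar product $(\cdot,\cdot)$ with $p$ positive and $q$ negative squares). Everything is smooth ($C^\infty$). A totally nonisotropic $N$-dimensional submanifold of $E$ is given by a parametrization $r:U\to E$, $U\subset\mathbb R^N$ open, such that the vectors $r_{u^1},\dots,r_{u^N}$ are linearly independent and the first fundamental form $g_{ij}=(r_{u^i},r_{u^j})$ is nondegenerate at every point. A normal frame with Gram matrix $\mu$ consists of smooth fields $n_1,\dots,n_L$ that form a basis of the normal space at every point of $U$ and satisfy $(n_\alpha,n_\beta)=\mu_{\alpha\beta}=\mathrm{const}$; its torsion forms are $\varkappa_{\alpha\beta,i}=(n_{\alpha,u^i},n_\beta)$, and the corresponding second fundamental forms are $\omega_{\alpha,ij}=(n_\alpha,r_{u^iu^j})$. The submanifold is called flat torsionless if the Riemann curvature tensor of $g$ vanishes and there is a normal frame on $U$ with constant Gram matrix all of whose torsion forms vanish (a torsionless frame). The coordinates $u$ are called flat if $g_{ij}(u)=\eta_{ij}$ is constant. Signature means the pair of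 the numbers of positive and negative squares. For constant symmetric nondegenerate matrices $\eta=(\eta_{ij})$ ($N\times N$) and $\mu=(\mu_{\alpha\beta})$ ($L\times L$), with inverses $(\eta^{ij})$ and $(\mu^{\alpha\beta})$, consider the following system for functions $\psi_1,\dots,\psi_L$ on $U$: $$\sum_{\alpha,\beta=1}^L\mu^{\alpha\beta}\left(\frac{\partial^2\psi_\alpha}{\partial u^i\partial u^k}\frac{\partial^2\psi_\beta}{\partial u^j\partial u^l}-\frac{\partial^2\psi_\alpha}{\partial u^i\partial u^l}\frac{\partial^2\psi_\beta}{\partial u^j\partial u^k}\right)=0\quad\text{for all } i,j,k,l,\qquad(\mathrm{G})$$ $$\sum_{i,j=1}^N\eta^{ij}\left(\frac{\partial^2\psi_\alpha}{\partial u^i\partial u^k}\frac{\partial^2\psi_\beta}{\partial u^j\partial u^l}-\frac{\partial^2\psi_\alpha}{\partial u^i\partial u^l}\frac{\partial^2\psi_\beta}{\partial u^j\partial u^k}\right)=0\quad\text{for all } \alpha,\beta,k,l.\qquad(\mathrm{R})$$ Then the class of $N$-dimensional flat torsionless submanifolds of $E$ is described, in flat coordinates, by the system (G), (R): 1. Near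 each of its points, a flat torsionless submanifold can be smoothly reparametrized, over a simply connected coordinate domain, in flat coordinates, and it remains flat torsionless. 2. Let $U$ be open and simply connected, let $r:U\to E$ be a flat torsionless submanifold in flat coordinates with first fundamental form $\eta_{ij}\,du^i\,du^j$, and let $n_1,\dots,n_L$ be a torsionless normal frame on $U$ with Gram matrix $\mu$. Then $\eta$ and $\mu$ are symmetric and nondegenerate, the signature $(p,q)$ of $E$ is the sum of the signatures of $\eta$ and $\mu$, and there are smooth functions $\psi_1,\dots,\psi_L$ on $U$ that satisfy (G), (R) and have the second fundamental forms as their Hessians, $\omega_{\alpha,ij}=\partial^2\psi_\alpha/\partial u^i\partial u^j$. The $\psi_\alpha$ are unique exactly up to adding affine functions of $u^1,\dots,u^N$. 3. Conversely, let $U$ be open and simply connected, let $\eta,\mu$ be constant symmetric nondegenerate matrices whose signatures add up to $(p,q)$, and let smooth functions $\psi_1,\dots,\psi_L$ on $U$ satisfy (G), (R). Then there is a flat torsionless submanifold $r:U\to E$ with first fundamental form $\eta_{ij}\,du^i\,du^j$ and a torsionless normal frame on $U$ with Gram matrix $\mu$ whose second fundamental forms are $\frac{\partial^2\psi_\alpha}{\partial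 u^i\partial u^j}\,du^i\,du^j$. It is unique up to motions: any other such pair $(r',n')$ is $r'=Ar+b$, $n'_\alpha=An_\alpha$ with a linear isometry $A$ of $E$ and a vector $b\in E$. -/

import Mathlib

open scoped ContDiff

noncomputable section

namespace FlatTorsionless

/-- The points (and vectors) of the pseudo-Euclidean space of signature `(p, q)`, in Cartesian
coordinates. -/
abbrev PseudoEuclidean (p q : ℕ) : Type := Fin p ⊕ Fin q → ℝ

/-- The scalar product of the pseudo-Euclidean space of signature `(p, q)`. -/
def pseudoInner {p q : ℕ} (x y : PseudoEuclidean p q) : ℝ :=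
  (∑ a : Fin p, x (Sum.inl a) * y (Sum.inl a)) - ∑ b : Fin q, x (Sum.inr b) * y (Sum.inr b)

/-- The partial derivative `∂f/∂uⁱ` at `u`. -/
def pd {N : ℕ} {E : Type*} [NormedAddCommGroup E] [NormedSpace ℝ E]
    (i : Fin N) (f : (Fin N → ℝ) → E) (u : Fin N → ℝ) : E :=
  fderiv ℝ f u (Pi.single i 1)

/-- The Hessian `∂²f/∂uⁱ∂uʲ` of a function. -/
def hessian {N : ℕ} (f : (Fin N → ℝ) → ℝ) (u : Fin N → ℝ) : Matrix (Fin N) (Fin N) ℝ :=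
  Matrix.of fun i j => pd i (pd j f) u

/-- The first fundamental form `g_ij = (r_{uⁱ}, r_{uʲ})` of a parametrized submanifold. -/
def firstForm {N p q : ℕ} (r : (Fin N → ℝ) → PseudoEuclidean p q) (u : Fin N → ℝ) :
    Matrix (Fin N) (Fin N) ℝ :=
  Matrix.of fun i j => pseudoInner (pd i r u) (pd j r u)

/-- `r : U → E` parametrizes a smooth totally nonisotropic submanifold: its Jacobi matrix has
rank `N` and the induced metric is nondegenerate. -/
structure IsNonisotropicSubmanifold {N p q : ℕ} (U : Set (Fin N → ℝ))
    (r : (Fin N → ℝ) → PseudoEuclidean p q) : Prop where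
  smooth : ContDiffOn ℝ ∞ r U
  immersion : ∀ u ∈ U, LinearIndependent ℝ fun i : Fin N => pd i r u
  nonisotropic : ∀ u ∈ U, (firstForm r u).det ≠ 0

/-- The Christoffel symbols `Γᵏ_ij` of the Levi-Civita connection of a metric `g`. -/
def christoffel {N : ℕ} (g : (Fin N → ℝ) → Matrix (Fin N) (Fin N) ℝ)
    (k i j : Fin N) (u : Fin N → ℝ) : ℝ :=
  (1 / 2) * ∑ s : Fin N, (g u)⁻¹ k s *
    (pd i (fun v => g v s j) u + pd j (fun v => g v i s) u - pd s (fun v => g v i j) u)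

/-- The Riemann curvature tensor `Rˡ_kij` of a metric `g`. -/
def riemann {N : ℕ} (g : (Fin N → ℝ) → Matrix (Fin N) (Fin N) ℝ)
    (l k i j : Fin N) (u : Fin N → ℝ) : ℝ :=
  pd i (christoffel g l j k) u - pd j (christoffel g l i k) u +
    ∑ m : Fin N, (christoffel g l i m u * christoffel g m j k u -
      christoffel g l j m u * christoffel g m i k u)

/-- The metric `g` is flat on `U`: its Riemann curvature tensor vanishes. -/
def IsFlatMetric {N : ℕ} (U : Set (Fin N → ℝ))
    (g : (Fin N → ℝ) → Matrix (Fin N) (Fin N) ℝ) : Prop :=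
  ∀ u ∈ U, ∀ l k i j : Fin N, riemann g l k i j u = 0

/-- `u¹, …, uᴺ` are flat coordinates on the submanifold: the first fundamental form is given by
the constant matrix `η`. -/
def IsFlatCoordinates {N p q : ℕ} (U : Set (Fin N → ℝ))
    (r : (Fin N → ℝ) → PseudoEuclidean p q) (η : Matrix (Fin N) (Fin N) ℝ) : Prop :=
  ∀ u ∈ U, firstForm r u = η

/-- `n₁, …, n_L` are smooth vector fields that form, at each point, a basis of the normal space
with the constant Gram matrix `μ`. -/
structure IsNormalFrame {N L p q : ℕ} (U : Set (Fin N → ℝ))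
    (r : (Fin N → ℝ) → PseudoEuclidean p q) (μ : Matrix (Fin L) (Fin L) ℝ)
    (n : Fin L → (Fin N → ℝ) → PseudoEuclidean p q) : Prop where
  smooth : ∀ α, ContDiffOn ℝ ∞ (n α) U
  normal : ∀ u ∈ U, ∀ α i, pseudoInner (n α u) (pd i r u) = 0
  linearIndependent : ∀ u ∈ U, LinearIndependent ℝ fun α => n α u
  span : ∀ u ∈ U, ∀ x : PseudoEuclidean p q, (∀ i, pseudoInner x (pd i r u) = 0) →
    x ∈ Submodule.span ℝ (Set.range fun α => n α u)
  gram : ∀ u ∈ U, ∀ α β, pseudoInner (n α u) (n β u) = μ α β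

/-- The coefficients `ϰ_{αβ,i} = (n_{α,uⁱ}, n_β)` of the torsion forms. -/
def torsionForm {N L p q : ℕ} (n : Fin L → (Fin N → ℝ) → PseudoEuclidean p q)
    (α β : Fin L) (i : Fin N) (u : Fin N → ℝ) : ℝ :=
  pseudoInner (pd i (n α) u) (n β u)

/-- A normal frame with Gram matrix `μ`, all of whose torsion forms vanish. -/
def IsTorsionlessFrame {N L p q : ℕ} (U : Set (Fin N → ℝ))
    (r : (Fin N → ℝ) → PseudoEuclidean p q) (μ : Matrix (Fin L) (Fin L) ℝ)
    (n : Fin L → (Fin N → ℝ) → PseudoEuclidean p q) : Prop :=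
  IsNormalFrame U r μ n ∧ ∀ u ∈ U, ∀ α β i, torsionForm n α β i u = 0

/-- The second fundamental forms `ω_{α,ij} = (n_α, r_{uⁱuʲ})`. -/
def secondForm {N L p q : ℕ} (r : (Fin N → ℝ) → PseudoEuclidean p q)
    (n : Fin L → (Fin N → ℝ) → PseudoEuclidean p q) (α : Fin L) (u : Fin N → ℝ) :
    Matrix (Fin N) (Fin N) ℝ :=
  Matrix.of fun i j => pseudoInner (n α u) (pd i (pd j r) u)

/-- A flat torsionless submanifold of codimension `L`, given by a parametrization. -/
def IsFlatTorsionless {N p q : ℕ} (L : ℕ) (U : Set (Fin N → ℝ))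
    (r : (Fin N → ℝ) → PseudoEuclidean p q) : Prop :=
  IsNonisotropicSubmanifold U r ∧ IsFlatMetric U (firstForm r) ∧
    ∃ (μ : Matrix (Fin L) (Fin L) ℝ) (n : Fin L → (Fin N → ℝ) → PseudoEuclidean p q),
      IsTorsionlessFrame U r μ n

/-- The Gauss equations for the functions `ψ_α`; `μ⁻¹` has the entries `μ^{αβ}`. -/
def GaussEquations {N L : ℕ} (U : Set (Fin N → ℝ)) (μ : Matrix (Fin L) (Fin L) ℝ)
    (ψ : Fin L → (Fin N → ℝ) → ℝ) : Prop :=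
  ∀ u ∈ U, ∀ i j k l : Fin N, ∑ α : Fin L, ∑ β : Fin L, μ⁻¹ α β *
    (hessian (ψ α) u i k * hessian (ψ β) u j l - hessian (ψ α) u i l * hessian (ψ β) u j k) = 0

/-- The Ricci equations for the functions `ψ_α`; `η⁻¹` has the entries `η^{ij}`. -/
def RicciEquations {N L : ℕ} (U : Set (Fin N → ℝ)) (η : Matrix (Fin N) (Fin N) ℝ)
    (ψ : Fin L → (Fin N → ℝ) → ℝ) : Prop :=
  ∀ u ∈ U, ∀ (α β : Fin L) (k l : Fin N), ∑ i : Fin N, ∑ j : Fin N, η⁻¹ i j *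
    (hessian (ψ α) u i k * hessian (ψ β) u j l - hessian (ψ α) u i l * hessian (ψ β) u j k) = 0

/-- A solution `ψ₁, …, ψ_L` on `U` of the system of the Gauss and the Ricci equations. -/
structure IsSolution {N L : ℕ} (U : Set (Fin N → ℝ)) (η : Matrix (Fin N) (Fin N) ℝ)
    (μ : Matrix (Fin L) (Fin L) ℝ) (ψ : Fin L → (Fin N → ℝ) → ℝ) : Prop where
  smooth : ∀ α, ContDiffOn ℝ ∞ (ψ α) U
  gauss : GaussEquations U μ ψ
  ricci : RicciEquations U η ψ

/-- A constant metric: a symmetric nondegenerate matrix. -/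
def IsMetricMatrix {n : ℕ} (A : Matrix (Fin n) (Fin n) ℝ) : Prop :=
  A.IsSymm ∧ A.det ≠ 0

/-- The signature (numbers of positive and of negative squares) of a symmetric matrix. -/
def signature {n : ℕ} (A : Matrix (Fin n) (Fin n) ℝ) : ℕ × ℕ :=
  (sigPos A.toQuadraticForm', sigNeg A.toQuadraticForm')

/-- The pair `(r, n)` realizes `ψ`: in flat coordinates, a flat torsionless submanifold with
first fundamental form `η`, a normal frame `n` with Gram matrix `μ` and zero torsion, and the
Hessians of the `ψ_α` as second fundamental forms. -/
structure Realizes {N L p q : ℕ} (U : Set (Fin N → ℝ)) (η : Matrix (Fin N) (Fin N) ℝ)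
    (μ : Matrix (Fin L) (Fin L) ℝ) (ψ : Fin L → (Fin N → ℝ) → ℝ)
    (r : (Fin N → ℝ) → PseudoEuclidean p q)
    (n : Fin L → (Fin N → ℝ) → PseudoEuclidean p q) : Prop where
  flatTorsionless : IsFlatTorsionless L U r
  flatCoordinates : IsFlatCoordinates U r η
  frame : IsTorsionlessFrame U r μ n
  secondForm_eq : ∀ u ∈ U, ∀ α, secondForm r n α u = hessian (ψ α) u

end FlatTorsionless

end

open scoped ContDiff
open Set Filter Topology Metric

/-! Everything rests on one integration theorem, `exists_matrix_solution`: on a simply connected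
open set, ∂_i F = F Ω_i has an invertible smooth solution as soon as ∂_i Ω_j + Ω_i Ω_j is symmetric
in i, j. It is proved for dF = F A in a Banach algebra. Locally the equation is solved along rays
(`exists_local_solution`). Two local solutions differ by a locally constant left factor, so they
form a covering, which has a section over a simply connected base (`exists_global_section`). The 1×1
case is the Poincaré lemma (`exists_potential`).

Let F have the columns r_{u^i} and n_α, let J be the diagonal matrix of the signs of E, and let S be
the inverse of diag(η, μ). In flat coordinates the second derivatives of r are normal, and for a
torsionless frame the derivatives of the n_α are tangential. Hence ∂_i F = F Ω_i, where Ω_i is block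
off-diagonal and built from the second fundamental forms. The compatibility condition splits by
blocks. The off-diagonal part, ∂_i Ω_j = ∂_j Ω_i, is Codazzi and says that the second forms are
Hessians. The diagonal part, [Ω_i, Ω_j] = 0, is (G) together with (R). This gives both directions of
the correspondence.

Since Ω_i is skew with respect to S, the product F' S Fᵀ is constant for any two solutions
(`mul_mul_transpose_const`). With F' = F this carries the Gram relations from one point to all of U;
with two different frames it produces the motion. Sylvester's law decides whether an initial frame
exists: one with Gram matrix diag(η, μ) forces the signatures to add up to (p, q), and conversely
(`signature_eq_of_gram`, `exists_gram_eq_block`).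

Flat coordinates come from the same tools with the Levi-Civita connection matrices in place of Ω_i.
Zero curvature gives a parallel coframe F, the symmetry of the Christoffel symbols makes it exact,
and the constancy of F g⁻¹ Fᵀ says that the metric is constant in the new coordinates. -/

namespace FlatTorsionless

/-! ### Local solutions of dF = F A. -/

section LocalSolution

variable {E 𝔸 : Type*} [NormedAddCommGroup E] [NormedSpace ℝ E]
  [NormedRing 𝔸] [NormedAlgebra ℝ 𝔸]

/-- The Pfaffian equation `dF = F A` along `U`. -/
def SolvesPfaffian (A : E → E →L[ℝ] 𝔸) (F : E → 𝔸) (u : E) : Prop :=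
  HasFDerivAt F ((ContinuousLinearMap.mul ℝ 𝔸 (F u)).comp (A u)) u

/-- The bound 1/2 lets Picard–Lindelöf reach all of [0, 1] at once: on the ball of radius ‖1‖ + 1
about 1 the field has norm at most (2‖1‖ + 1) / 2, so a solution cannot leave the ball before time
1. -/
theorem exists_linear_ode_solution [CompleteSpace 𝔸] (B : ℝ → 𝔸)
    (hB : ContinuousOn B (Icc 0 1)) (hB1 : ∀ t ∈ Icc (0 : ℝ) 1, ‖B t‖ ≤ 1 / 2) :
    ∃ f : ℝ → 𝔸, f 0 = 1 ∧ ∀ t ∈ Icc (0 : ℝ) 1,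
      HasDerivWithinAt f (f t * B t) (Icc 0 1) t := by
  have h0 : (0 : ℝ) ∈ Icc (0 : ℝ) 1 := by simp
  have key : IsPicardLindelof (fun t f => f * B t) (⟨0, h0⟩ : Icc (0 : ℝ) 1) (1 : 𝔸)
      (‖(1 : 𝔸)‖₊ + 1) 0 (‖(1 : 𝔸)‖₊ + 1) 1 := by
    refine ⟨fun t ht => ?_, fun x _ => ?_, fun t ht x hx => ?_, ?_⟩
    · refine LipschitzOnWith.of_dist_le_mul fun x _ y _ => ?_
      rw [dist_eq_norm, dist_eq_norm, ← sub_mul]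
      have := norm_mul_le (x - y) (B t)
      have := mul_le_mul_of_nonneg_left (hB1 t ht) (norm_nonneg (x - y))
      push_cast
      linarith [norm_nonneg (x - y)]
    · exact continuousOn_const.mul hB
    · have h1 := norm_mul_le x (B t)
      have h2 := mul_le_mul_of_nonneg_left (hB1 t ht) (norm_nonneg x)
      rw [mem_closedBall, dist_eq_norm] at hx
      have h3 := norm_le_norm_add_norm_sub' x (1 : 𝔸)
      push_cast at hx ⊢
      linarith
    · simp
  obtain ⟨f, hf, hf'⟩ := key.exists_eq_forall_mem_Icc_hasDerivWithinAt₀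
  exact ⟨f, hf, hf'⟩

theorem norm_le_of_linear_ode {f g : ℝ → 𝔸} {ε δ : ℝ}
    (hf : ∀ t ∈ Icc (0 : ℝ) 1, HasDerivWithinAt f (g t) (Icc 0 1) t)
    (h0 : ‖f 0‖ ≤ δ) (hg : ∀ t ∈ Icc (0 : ℝ) 1, ‖g t‖ ≤ 1 * ‖f t‖ + ε) :
    ∀ t ∈ Icc (0 : ℝ) 1, ‖f t‖ ≤ gronwallBound δ 1 ε t := by
  have := norm_le_gronwallBound_of_norm_deriv_right_le (f := f) (f' := g) (δ := δ) (K := 1)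
    (ε := ε) (a := 0) (b := 1) (fun t ht => (hf t ht).continuousWithinAt)
    (fun t ht => ((hf t (Ico_subset_Icc_self ht)).mono_of_mem_nhdsWithin
      (Icc_mem_nhdsGE_of_mem ht))) h0 (fun t ht => hg t (Ico_subset_Icc_self ht))
  simpa using this

/-- `f₁` and `f₀` solve the equation along the rays with velocities v + h and v. To first order in h
one expects f₁ = f₀ (1 + t A(h)). Flatness cancels the terms linear in h in the derivative of the
difference, so the difference obeys the same linear equation with a forcing term quadratic in h. -/
theorem hasDerivWithinAt_ray_defect {A : E → E →L[ℝ] 𝔸} {A' : E →L[ℝ] E →L[ℝ] 𝔸} {x v h : E}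
    {f₁ f₀ : ℝ → 𝔸} {t : ℝ} {s : Set ℝ} (hA : HasFDerivAt A A' (x + t • v))
    (h₁ : HasDerivWithinAt f₁ (f₁ t * A (x + t • v + t • h) (v + h)) s t)
    (h₀ : HasDerivWithinAt f₀ (f₀ t * A (x + t • v) v) s t)
    (hflat : A' v h + A (x + t • v) v * A (x + t • v) h =
      A' h v + A (x + t • v) h * A (x + t • v) v) :
    HasDerivWithinAt (fun t => f₁ t - f₀ t * (1 + t • A (x + t • v) h))
      ((f₁ t - f₀ t * (1 + t • A (x + t • v) h)) * A (x + t • v + t • h) (v + h) +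
        f₀ t * ((1 + t • A (x + t • v) h) *
          (A (x + t • v + t • h) - A (x + t • v) - A' (t • h)) (v + h)
        + t • A' h h + t • (A (x + t • v) h * A (x + t • v) h)
        + t ^ 2 • (A (x + t • v) h * A' h (v + h)))) s t := by
  have hray : HasDerivAt (fun t : ℝ => x + t • v) v t := by
    simpa using ((hasDerivAt_id t).smul_const v).const_add x
  have h2 : HasDerivAt (fun t : ℝ => A (x + t • v) h) (A' v h) t := by
    have h4 : HasDerivAt (fun t : ℝ => A (x + t • v)) (A' v) t := hA.comp_hasDerivAt t hray
    exact (ContinuousLinearMap.apply ℝ 𝔸 h).hasFDerivAt.comp_hasDerivAt t h4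
  have h3 := ((hasDerivAt_id t).smul h2).const_add 1
  refine (h₁.sub (h₀.mul h3.hasDerivWithinAt)).congr_deriv ?_
  have hflat' : A' v h = A' h v + A (x + t • v) h * A (x + t • v) v
      - A (x + t • v) v * A (x + t • v) h := eq_sub_of_add_eq hflat
  simp only [Pi.smul_apply', id, hflat', one_smul, sub_apply, map_smul,
    smul_apply, map_add]
  generalize A (x + t • v) h = a
  generalize A (x + t • v) v = b
  generalize A (x + t • v + t • h) h = c
  generalize A (x + t • v + t • h) v = c'
  generalize A' h h = d
  generalize A' h v = e
  simp only [mul_add, add_mul, mul_sub, sub_mul, smul_mul_assoc, mul_smul_comm, mul_assoc,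
    smul_add, smul_sub, mul_one, one_mul]
  module

/-- The quantitative form of "quadratic in h". In the application κ is a Lipschitz constant of the
derivative of A, so that `h₁` bounds the Taylor remainder of A. -/
theorem norm_ray_defect_le {L₀ L₁ : E →L[ℝ] 𝔸} {D : E →L[ℝ] E →L[ℝ] 𝔸} {w h : E}
    {t a a' κ δ : ℝ} (ht : t ∈ Icc (0 : ℝ) 1) (h₀ : ‖L₀‖ ≤ a) (hD : ‖D‖ ≤ a')
    (h₁ : ‖L₁ - L₀ - D (t • h)‖ ≤ κ * ‖h‖ ^ 2) (hw : ‖w‖ ≤ δ) (hh : ‖h‖ ≤ 2 * δ) :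
    ‖(1 + t • L₀ h) * (L₁ - L₀ - D (t • h)) w + t • D h h + t • (L₀ h * L₀ h)
        + t ^ 2 • (L₀ h * D h w)‖ ≤
      ((‖(1 : 𝔸)‖ + a * (2 * δ)) * (κ * δ) + a' + a * a + a * a' * δ) * ‖h‖ ^ 2 := by
  have a0 : 0 ≤ a := (norm_nonneg _).trans h₀
  have a'0 : 0 ≤ a' := D.opNorm_nonneg.trans hD
  have δ0 : 0 ≤ δ := (norm_nonneg _).trans hw
  have κ0 : 0 ≤ κ * ‖h‖ ^ 2 := (norm_nonneg _).trans h₁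
  have hL : ‖L₀ h‖ ≤ a * ‖h‖ := L₀.le_of_opNorm_le h₀ h
  have hDh : ‖D h‖ ≤ a' * ‖h‖ := D.le_of_opNorm_le hD h
  have hsm : ∀ (s : ℝ) (y : 𝔸), s ∈ Icc (0 : ℝ) 1 → ‖s • y‖ ≤ ‖y‖ := fun s y hs => by
    rw [norm_smul, Real.norm_of_nonneg hs.1]
    exact mul_le_of_le_one_left (norm_nonneg _) hs.2
  have e1 : ‖(1 + t • L₀ h) * (L₁ - L₀ - D (t • h)) w‖ ≤
      (‖(1 : 𝔸)‖ + a * (2 * δ)) * (κ * ‖h‖ ^ 2 * δ) := by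
    refine (norm_mul_le _ _).trans ?_
    gcongr
    · refine (norm_add_le _ _).trans ?_
      gcongr
      refine (hsm _ _ ht).trans (hL.trans ?_)
      gcongr
    · refine (ContinuousLinearMap.le_of_opNorm_le _ h₁ w).trans ?_
      gcongr
  have e2 : ‖t • D h h‖ ≤ a' * ‖h‖ * ‖h‖ :=
    (hsm _ _ ht).trans ((D h).le_of_opNorm_le hDh h)
  have e3 : ‖t • (L₀ h * L₀ h)‖ ≤ (a * ‖h‖) * (a * ‖h‖) := by
    refine (hsm _ _ ht).trans ((norm_mul_le _ _).trans ?_)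
    gcongr
  have e4 : ‖t ^ 2 • (L₀ h * D h w)‖ ≤ (a * ‖h‖) * (a' * ‖h‖ * δ) := by
    refine (hsm _ _ ⟨sq_nonneg t, pow_le_one₀ ht.1 ht.2⟩).trans ((norm_mul_le _ _).trans ?_)
    gcongr
    refine ((D h).le_of_opNorm_le hDh w).trans ?_
    gcongr
  refine (norm_add_le _ _).trans ((add_le_add ((norm_add_le _ _).trans (add_le_add
    ((norm_add_le _ _).trans (add_le_add e1 e2)) e3)) e4).trans (le_of_eq ?_))
  ring

/-- A flat form `A` has near each point a solution of `dF = F A`. -/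
theorem exists_local_solution [CompleteSpace 𝔸] {U : Set E} (hU : IsOpen U)
    {A : E → E →L[ℝ] 𝔸} (hA : ContDiffOn ℝ ∞ A U)
    (hflat : ∀ u ∈ U, ∀ v w, fderiv ℝ A u v w + A u v * A u w =
      fderiv ℝ A u w v + A u w * A u v) {x : E} (hx : x ∈ U) :
    ∃ δ > 0, ball x δ ⊆ U ∧ ∃ F : E → 𝔸, F x = 1 ∧ ∀ u ∈ ball x δ, SolvesPfaffian A F u := by
  have hAx : ContDiffAt ℝ ∞ A x := hA.contDiffAt (hU.mem_nhds hx)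
  obtain ⟨K, s, hs, hK⟩ := ((hAx.fderiv_right (m := 1) (by norm_cast)).exists_lipschitzOnWith)
  set a := ‖A x‖ + 1 with ha
  set a' := ‖fderiv ℝ A x‖ + 1 with ha'
  have hc0 : ∀ᶠ y in 𝓝 x, ‖A y‖ < a :=
    hAx.continuousAt.norm.eventually_lt continuousAt_const (by simp [ha])
  have hc1 : ∀ᶠ y in 𝓝 x, ‖fderiv ℝ A y‖ < a' :=
    (hAx.fderiv_right (m := 0) (by norm_cast)).continuousAt.norm.eventually_lt
      continuousAt_const (by simp [ha'])
  obtain ⟨δ₁, hδ₁, hball⟩ := Metric.eventually_nhds_iff_ball.1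
    ((hc0.and hc1).and ((hU.eventually_mem hx).and (eventually_mem_set.2 hs)))
  have a0 : 0 < a := by positivity
  have a'0 : 0 < a' := by positivity
  -- This radius gives a * δ ≤ 1 / 2, the bound that the ray equation needs on all of [0, 1].
  set δ := min δ₁ (1 / (2 * a)) with hδdef
  have hδ : 0 < δ := by positivity
  have hδ₁' : δ ≤ δ₁ := min_le_left _ _
  have haδ : a * δ ≤ 1 / 2 := by
    have : δ ≤ 1 / (2 * a) := min_le_right _ _
    calc a * δ ≤ a * (1 / (2 * a)) := by gcongr
      _ = 1 / 2 := by field_simp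
  have hb : ∀ y ∈ ball x δ, ‖A y‖ ≤ a ∧ ‖fderiv ℝ A y‖ ≤ a' ∧ y ∈ U ∧ y ∈ s := fun y hy => by
    obtain ⟨⟨h1, h2⟩, h3, h4⟩ := hball y (ball_subset_ball hδ₁' hy)
    exact ⟨h1.le, h2.le, h3, h4⟩
  have hray : ∀ y ∈ ball x δ, ∀ t ∈ Icc (0 : ℝ) 1, x + t • (y - x) ∈ ball x δ := by
    intro y hy t ht
    have := (convex_ball x δ).add_smul_sub_mem (mem_ball_self hδ) hy ht
    exact this
  have hnorm : ∀ y ∈ ball x δ, ‖y - x‖ ≤ δ := fun y hy => by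
    rw [← dist_eq_norm]; exact (mem_ball.1 hy).le
  have hdA : ∀ y ∈ ball x δ, HasFDerivAt A (fderiv ℝ A y) y := fun y hy =>
    ((hA.contDiffAt (hU.mem_nhds (hb y hy).2.2.1)).differentiableAt (by simp)).hasFDerivAt
  have hrayd : ∀ y t, HasDerivAt (fun t : ℝ => x + t • (y - x)) (y - x) t := fun y t => by
    simpa using ((hasDerivAt_id t).smul_const (y - x)).const_add x
  have hAB : ∀ y ∈ ball x δ, ∀ t ∈ Icc (0 : ℝ) 1,
      ‖A (x + t • (y - x)) (y - x)‖ ≤ 1 / 2 := fun y hy t ht =>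
    calc _ ≤ ‖A (x + t • (y - x))‖ * ‖y - x‖ := ContinuousLinearMap.le_opNorm _ _
      _ ≤ a * δ := by
        gcongr
        exacts [(hb _ (hray y hy t ht)).1, hnorm y hy]
      _ ≤ 1 / 2 := haδ
  have hex : ∀ y ∈ ball x δ, ∃ f : ℝ → 𝔸, f 0 = 1 ∧ ∀ t ∈ Icc (0 : ℝ) 1,
      HasDerivWithinAt f (f t * A (x + t • (y - x)) (y - x)) (Icc 0 1) t := by
    intro y hy
    refine exists_linear_ode_solution (fun t => A (x + t • (y - x)) (y - x)) ?_ (hAB y hy)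
    intro t ht
    have h1 : ContinuousAt (fun t : ℝ => A (x + t • (y - x))) t :=
      ContinuousAt.comp (f := fun t : ℝ => x + t • (y - x))
        (hdA _ (hray y hy t ht)).continuousAt (hrayd y t).continuousAt
    exact (h1.clm_apply continuousAt_const).continuousWithinAt
  choose! f hf0 hf using hex
  set M := gronwallBound ‖(1 : 𝔸)‖ 1 0 1 with hM
  have hfM : ∀ y ∈ ball x δ, ∀ t ∈ Icc (0 : ℝ) 1, ‖f y t‖ ≤ M := by
    intro y hy t ht
    refine (norm_le_of_linear_ode (ε := 0) (hf y hy) (by rw [hf0 y hy]) ?_ t ht).trans ?_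
    · intro t ht
      refine (norm_mul_le _ _).trans ?_
      nlinarith [hAB y hy t ht, norm_nonneg (f y t)]
    · rw [hM, gronwallBound_ε0, gronwallBound_ε0]
      gcongr
      exact ht.2
  have hM0 : 0 ≤ M := (norm_nonneg _).trans (hfM x (mem_ball_self hδ) 0 (by simp))
  set C := (‖(1 : 𝔸)‖ + a * (2 * δ)) * (K * δ) + a' + a * a + a * a' * δ with hC
  have hfx : ∀ t ∈ Icc (0 : ℝ) 1, f x t = 1 := by
    intro t ht
    have hx0 := mem_ball_self (x := x) hδ
    refine constant_of_has_deriv_right_zero (f := f x) (a := 0) (b := 1)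
      (fun t ht => (hf x hx0 t ht).continuousWithinAt) (fun t ht => ?_) t ht |>.trans (hf0 x hx0)
    have := (hf x hx0 t (Ico_subset_Icc_self ht)).mono_of_mem_nhdsWithin
      (Icc_mem_nhdsGE_of_mem ht)
    simpa using this
  -- The solution is F y = f y 1. Grönwall with zero initial defect bounds F (y + h) - F y - F y * A
  -- y h by a multiple of ‖h‖², which is differentiability with the required derivative.
  have hmain : ∀ y ∈ ball x δ, ∀ h, y + h ∈ ball x δ →
      ‖f (y + h) 1 - f y 1 - f y 1 * A y h‖ ≤ gronwallBound 0 1 (M * (C * ‖h‖ ^ 2)) 1 := by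
    intro y hy h hyh
    set v := y - x with hv
    have hvh : y + h - x = v + h := by rw [hv]; abel
    have hvδ : ‖v‖ ≤ δ := hnorm y hy
    have hvhδ : ‖v + h‖ ≤ δ := hvh ▸ hnorm _ hyh
    have hhδ : ‖h‖ ≤ 2 * δ := by
      have := norm_sub_le (v + h) v
      rw [add_sub_cancel_left] at this
      linarith
    have hz : ∀ t ∈ Icc (0 : ℝ) 1, x + t • v ∈ ball x δ := hray y hy
    have hzh : ∀ t : ℝ, x + t • (y + h - x) = x + t • v + t • h := fun t => by
      rw [hvh, smul_add, add_assoc]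
    have hder := fun t (ht : t ∈ Icc (0 : ℝ) 1) => by
      have h1 := hf _ hyh t ht
      rw [hzh, hvh] at h1
      exact hasDerivWithinAt_ray_defect (hdA _ (hz t ht)) h1 (hf y hy t ht)
        (hflat _ (hb _ (hz t ht)).2.2.1 v h)
    have hZ1 : x + v = y := by simp [hv]
    have := norm_le_of_linear_ode (δ := 0) (ε := M * (C * ‖h‖ ^ 2)) hder
      (by simp [hf0 y hy, hf0 _ hyh]) (fun t ht => ?_) 1 (by simp)
    · simpa [hZ1, mul_add, sub_sub] using this
    · refine (norm_add_le _ _).trans (add_le_add ?_ ?_)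
      · refine (norm_mul_le _ _).trans ?_
        have := hAB _ hyh t ht
        rw [hzh, hvh] at this
        rw [one_mul]
        exact mul_le_of_le_one_right (norm_nonneg _) (this.trans (by norm_num))
      · refine (norm_mul_le _ _).trans ?_
        have hzt := hz t ht
        have hzht : x + t • v + t • h ∈ ball x δ := hzh t ▸ hray _ hyh t ht
        gcongr
        · exact hfM y hy t ht
        · refine norm_ray_defect_le ht (hb _ hzt).1 (hb _ hzt).2.1 ?_ hvhδ hhδ
          have hseg : segment ℝ (x + t • v) (x + t • v + t • h) ⊆ ball x δ :=
            (convex_ball x δ).segment_subset hzt hzht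
          have hth : ‖t • h‖ ≤ ‖h‖ := by
            rw [norm_smul, Real.norm_of_nonneg ht.1]
            exact mul_le_of_le_one_left (norm_nonneg _) ht.2
          have := (convex_segment (𝕜 := ℝ) (x + t • v) (x + t • v + t • h))
            |>.norm_image_sub_le_of_norm_hasFDerivWithin_le' (f := A) (f' := fderiv ℝ A)
              (φ := fderiv ℝ A (x + t • v)) (C := K * ‖h‖)
              (fun y hy => (hdA y (hseg hy)).hasFDerivWithinAt) (fun y hy => ?_)
              (left_mem_segment ℝ _ _) (right_mem_segment ℝ _ _)
          · rw [add_sub_cancel_left] at this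
            refine this.trans ?_
            rw [sq, ← mul_assoc]
            gcongr
          · refine (hK.norm_sub_le (hb _ (hseg hy)).2.2.2 (hb _ hzt).2.2.2).trans ?_
            gcongr
            refine (norm_sub_le_of_mem_segment hy).trans ?_
            rwa [add_sub_cancel_left]
  refine ⟨δ, hδ, fun y hy => (hb y hy).2.2.1, fun y => f y 1, hfx 1 (by simp), fun y hy => ?_⟩
  have hg : ∀ ε : ℝ, gronwallBound 0 1 ε 1 = ε * (Real.exp 1 - 1) := fun ε => by
    rw [gronwallBound_of_K_ne_0 one_ne_zero]; simp
  unfold SolvesPfaffian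
  rw [hasFDerivAt_iff_isLittleO_nhds_zero]
  refine Asymptotics.IsBigO.trans_isLittleO (g := fun h => ‖h‖ ^ 2) ?_ ?_
  · refine Asymptotics.IsBigO.of_bound (M * C * (Real.exp 1 - 1)) ?_
    have : ∀ᶠ h in 𝓝 (0 : E), y + h ∈ ball x δ := by
      have : ContinuousAt (fun h => y + h) (0 : E) := by fun_prop
      exact this.eventually_mem (by simpa using isOpen_ball.mem_nhds hy)
    filter_upwards [this] with h hh
    refine (hmain y hy h hh).trans (le_of_eq ?_)
    rw [hg, norm_pow, norm_norm]; ring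
  · exact Asymptotics.isLittleO_norm_pow_id one_lt_two

end LocalSolution

/-! ### Global solutions on simply connected domains. -/

/-- Local sections of a principal bundle with locally constant transition functions, over a
simply connected space, are locally constant multiples of a global one. -/
theorem exists_global_section {X G : Type*} [TopologicalSpace X] [SimplyConnectedSpace X]
    [LocallyPathConnectedSpace X] [Group G] (B : X → Set X) (hB : ∀ x, IsOpen (B x))
    (hmem : ∀ x, x ∈ B x) (Φ : X → X → G)
    (hΦ : ∀ i j, ∀ u ∈ B i ∩ B j, ∀ᶠ v in 𝓝 u, Φ i v * (Φ j v)⁻¹ = Φ i u * (Φ j u)⁻¹) (x₀ : X) :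
    ∃ F : X → G, F x₀ = 1 ∧ ∀ i, ∀ u ∈ B i, ∀ᶠ v in 𝓝 u, F v * (Φ i v)⁻¹ = F u * (Φ i u)⁻¹ := by
  -- With G discrete, continuous means locally constant, and a bundle with fibre G is a covering.
  let _ : TopologicalSpace G := ⊥
  have : DiscreteTopology G := ⟨rfl⟩
  let Z : FiberBundleCore X X G :=
    { baseSet := B
      isOpen_baseSet := hB
      indexAt := id
      mem_baseSet_at := hmem
      -- The coordinate c in the chart i stands for the value c * Φ i u, which must not depend on
      -- the chart.
      coordChange := fun i j u c => c * (Φ i u * (Φ j u)⁻¹)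
      coordChange_self := by simp
      continuousOn_coordChange := by
        rintro i j ⟨u, c⟩ ⟨hu, -⟩
        refine ContinuousAt.continuousWithinAt ?_
        refine (continuousAt_const (y := c * (Φ i u * (Φ j u)⁻¹))).congr ?_
        have h1 : ∀ᶠ c' in 𝓝 c, c' = c := by simp [nhds_discrete]
        filter_upwards [(hΦ i j u hu).prod_nhds h1] with p hp
        rw [hp.1, hp.2]
      coordChange_comp := by
        intro i j k x _ v
        group }
  have cov : IsCoveringMap (Bundle.TotalSpace.proj : Bundle.TotalSpace G Z.Fiber → X) :=
    FiberBundle.isCoveringMap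
  -- Simple connectivity lifts the identity map to a section; the starting point is chosen so that F
  -- x₀ = 1.
  obtain ⟨s, ⟨hs0, hs⟩, -⟩ := cov.existsUnique_continuousMap_lifts (ContinuousMap.id X) x₀
    (⟨x₀, ((Φ x₀ x₀)⁻¹ : G)⟩ : Bundle.TotalSpace G Z.Fiber) rfl
  have hproj : ∀ u, (s u).1 = u := fun u => congrFun hs u
  let c : X → G := fun u => (s u).2
  refine ⟨fun u => c u * Φ u u, ?_, fun i u hu => ?_⟩
  · have : c x₀ = (Φ x₀ x₀)⁻¹ := by
      change ((s x₀).2 : G) = _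
      rw [hs0]
    simp [this]
  -- Read in the chart i, the section is F * (Φ i)⁻¹; being continuous into a discrete space, it is
  -- locally constant.
  · have h1 : ContinuousAt (fun v => (Z.localTriv i (s v)).2) u := by
      have hsrc : s u ∈ (Z.localTriv i).source := by
        rw [Z.mem_localTriv_source]
        change (s u).1 ∈ B i
        rwa [hproj]
      exact ((Z.localTriv i).continuousAt hsrc |>.comp s.continuous.continuousAt).snd
    have h2 : ∀ v, (Z.localTriv i (s v)).2 = c v * Φ v v * (Φ i v)⁻¹ := by
      intro v
      change c v * (Φ (s v).1 (s v).1 * (Φ i (s v).1)⁻¹) = _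
      rw [hproj, mul_assoc]
    simp_rw [h2] at h1
    have := h1.eventually_mem (s := {c u * Φ u u * (Φ i u)⁻¹}) (by simp [nhds_discrete])
    simpa using this

section GlobalSolution

variable {E 𝔸 : Type*} [NormedAddCommGroup E] [NormedSpace ℝ E]
  [NormedRing 𝔸] [NormedAlgebra ℝ 𝔸] {A : E → E →L[ℝ] 𝔸} {U : Set E} {F : E → 𝔸}

/-- Bootstrapping: if F is of class Cⁿ, then so is dF = F A, hence F is of class Cⁿ⁺¹. -/
theorem SolvesPfaffian.contDiffOn (hU : IsOpen U) (hA : ContDiffOn ℝ ∞ A U)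
    (hF : ∀ u ∈ U, SolvesPfaffian A F u) : ContDiffOn ℝ ∞ F U := by
  rw [contDiffOn_infty]
  intro n
  induction n with
  | zero => exact contDiffOn_zero.2 fun u hu => (hF u hu).continuousAt.continuousWithinAt
  | succ n ih =>
    push_cast
    rw [contDiffOn_succ_iff_fderiv_of_isOpen hU]
    refine ⟨fun u hu => (hF u hu).differentiableAt.differentiableWithinAt, by simp, ?_⟩
    have h1 : ContDiffOn ℝ n (fun u => (ContinuousLinearMap.mul ℝ 𝔸 (F u)).comp (A u)) U :=
      ((ContinuousLinearMap.mul ℝ 𝔸).contDiff.comp_contDiffOn ih).clm_comp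
        (hA.of_le (by exact_mod_cast le_top))
    exact h1.congr fun u hu => (hF u hu).fderiv

/-- Two invertible solutions of `dF = F A` differ by a locally constant factor. -/
theorem SolvesPfaffian.eventually_mul_inv_eq [CompleteSpace 𝔸] {F G : E → 𝔸ˣ} {u : E}
    (hF : ∀ᶠ v in 𝓝 u, SolvesPfaffian A (fun v => (F v : 𝔸)) v)
    (hG : ∀ᶠ v in 𝓝 u, SolvesPfaffian A (fun v => (G v : 𝔸)) v) :
    ∀ᶠ v in 𝓝 u, F v * (G v)⁻¹ = F u * (G u)⁻¹ := by
  obtain ⟨δ, hδ, hb⟩ := Metric.eventually_nhds_iff_ball.1 (hF.and hG)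
  -- d(F G⁻¹) = F A G⁻¹ - F G⁻¹ (G A) G⁻¹ = 0.
  have hd : ∀ v ∈ ball u δ, HasFDerivAt (fun v => (F v * (G v)⁻¹ : 𝔸)) (0 : E →L[ℝ] 𝔸) v := by
    intro v hv
    obtain ⟨h1, h2⟩ := hb v hv
    have h3 : HasFDerivAt (fun v => (↑(G v)⁻¹ : 𝔸)) _ v :=
      ((hasFDerivAt_ringInverse (𝕜 := ℝ) (G v)).comp v h2).congr_of_eventuallyEq
        (Eventually.of_forall fun w => by simp)
    refine (h1.mul' h3).congr_fderiv ?_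
    ext w
    simp [mul_assoc]
  filter_upwards [ball_mem_nhds u hδ] with v hv
  refine Units.ext ?_
  push_cast
  exact (convex_ball u δ).is_const_of_fderivWithin_eq_zero (𝕜 := ℝ)
    (fun w hw => (hd w hw).differentiableAt.differentiableWithinAt)
    (fun w hw => by rw [fderivWithin_of_isOpen isOpen_ball hw, (hd w hw).fderiv]) hv
    (mem_ball_self hδ)

/-- A flat form `A` on a simply connected open set admits a global fundamental solution of
`dF = F A`. -/
theorem exists_global_solution [CompleteSpace 𝔸] (hU : IsOpen U) (hUs : IsSimplyConnected U)
    (hA : ContDiffOn ℝ ∞ A U)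
    (hflat : ∀ u ∈ U, ∀ v w, fderiv ℝ A u v w + A u v * A u w =
      fderiv ℝ A u w v + A u w * A u v) {x₀ : E} (hx₀ : x₀ ∈ U) :
    ∃ F : E → 𝔸ˣ, F x₀ = 1 ∧ ∀ u ∈ U, SolvesPfaffian A (fun v => (F v : 𝔸)) u := by
  classical
  have hloc : ∀ x : U, ∃ δ > 0, ball (x : E) δ ⊆ U ∧ ∃ F : E → 𝔸ˣ,
      ∀ u ∈ ball (x : E) δ, SolvesPfaffian A (fun v => (F v : 𝔸)) u := by
    intro x
    obtain ⟨δ, hδ, hb, F, hF1, hF⟩ := exists_local_solution hU hA hflat x.2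
    -- The local solution is 1 at the centre and units form an open set, so on a smaller ball it
    -- takes values in the group of units.
    have : ∀ᶠ v in 𝓝 (x : E), IsUnit (F v) :=
      (hF x (mem_ball_self hδ)).continuousAt.eventually_mem
        (Units.isOpen.mem_nhds (by simp [hF1]))
    obtain ⟨δ', hδ', hb'⟩ := Metric.eventually_nhds_iff_ball.1 this
    refine ⟨min δ δ', by positivity, (ball_subset_ball (min_le_left _ _)).trans hb,
      fun v => if h : IsUnit (F v) then h.unit else 1, fun u hu => ?_⟩
    have heq : ∀ v ∈ ball (x : E) (min δ δ'),
        (((if h : IsUnit (F v) then h.unit else 1 : 𝔸ˣ)) : 𝔸) = F v := fun v hv => by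
      rw [dif_pos (hb' v (ball_subset_ball (min_le_right _ _) hv))]; rfl
    have h1 := hF u (ball_subset_ball (min_le_left _ _) hu)
    unfold SolvesPfaffian at h1 ⊢
    beta_reduce
    rw [heq u hu]
    refine h1.congr_of_eventuallyEq ?_
    filter_upwards [isOpen_ball.mem_nhds hu] with v hv using heq v hv
  choose δ hδ hb Φ hΦ using hloc
  have := hUs.simplyConnectedSpace
  have := hU.locallyPathConnectedSpace
  have hΦev : ∀ i : U, ∀ u ∈ ball (i : E) (δ i),
      ∀ᶠ v in 𝓝 u, SolvesPfaffian A (fun v => (Φ i v : 𝔸)) v := fun i u hu => by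
    filter_upwards [isOpen_ball.mem_nhds hu] with v hv using hΦ i v hv
  obtain ⟨F, hF0, hF⟩ := exists_global_section (X := U)
    (fun x => Subtype.val ⁻¹' ball (x : E) (δ x))
    (fun x => isOpen_ball.preimage continuous_subtype_val) (fun x => mem_ball_self (hδ x))
    (fun i v => Φ i v) (fun i j u hu =>
      continuous_subtype_val.continuousAt.eventually
        (SolvesPfaffian.eventually_mul_inv_eq (hΦev i u hu.1) (hΦev j u hu.2))) ⟨x₀, hx₀⟩
  refine ⟨fun v => if h : v ∈ U then F ⟨v, h⟩ else 1, by simp [hx₀, hF0], fun u hu => ?_⟩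
  set i : U := ⟨u, hu⟩
  have hui : u ∈ ball (i : E) (δ i) := mem_ball_self (hδ i)
  have h1 := hF i i hui
  rw [show 𝓝 i = comap (↑) (𝓝 u) from nhds_subtype _ _, eventually_comap] at h1
  -- Near u the glued map is a constant times a local solution, and left multiplication by a
  -- constant preserves dF = F A.
  have h2 : ∀ᶠ v in 𝓝 u, (if h : v ∈ U then F ⟨v, h⟩ else 1) = F i * (Φ i u)⁻¹ * Φ i v := by
    filter_upwards [h1, hU.mem_nhds hu] with v hv hvU
    rw [dif_pos hvU, ← hv ⟨v, hvU⟩ rfl]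
    simp
  have h3 := hΦ i u hui
  unfold SolvesPfaffian at h3 ⊢
  have h4 := (ContinuousLinearMap.mul ℝ 𝔸 (F i * (Φ i u)⁻¹ : 𝔸ˣ)).hasFDerivAt.comp u h3
  refine (h4.congr_of_eventuallyEq ?_).congr_fderiv ?_
  · filter_upwards [h2] with v hv
    rw [hv]; simp
  · ext w
    simp [h2.self_of_nhds, mul_assoc]

end GlobalSolution

/-! ### Calculus of coordinate partial derivatives. -/

section PartialDerivatives

variable {N : ℕ} {E : Type*} [NormedAddCommGroup E] [NormedSpace ℝ E] {U : Set (Fin N → ℝ)}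
  {u : Fin N → ℝ}

theorem fderiv_apply_eq_sum_pd (f : (Fin N → ℝ) → E) (h : Fin N → ℝ) :
    fderiv ℝ f u h = ∑ i, h i • pd i f u := by
  conv_lhs => rw [← Finset.univ_sum_single h, map_sum]
  refine Finset.sum_congr rfl fun i _ => ?_
  have : (Pi.single i (h i) : Fin N → ℝ) = h i • Pi.single i 1 := by
    rw [← Pi.single_smul]; simp
  rw [this, map_smul, pd]

theorem contDiffOn_pd (hU : IsOpen U) {f : (Fin N → ℝ) → E} (hf : ContDiffOn ℝ ∞ f U) (i : Fin N) :
    ContDiffOn ℝ ∞ (pd i f) U :=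
  (hf.fderiv_of_isOpen hU (by simp)).clm_apply contDiffOn_const

theorem differentiableAt_of_contDiffOn (hU : IsOpen U) {f : (Fin N → ℝ) → E}
    (hf : ContDiffOn ℝ ∞ f U) (hu : u ∈ U) : DifferentiableAt ℝ f u :=
  (hf.contDiffAt (hU.mem_nhds hu)).differentiableAt (by simp)

theorem pd_comm (hU : IsOpen U) {f : (Fin N → ℝ) → E} (hf : ContDiffOn ℝ ∞ f U) (hu : u ∈ U)
    (i j : Fin N) : pd i (pd j f) u = pd j (pd i f) u := by
  have h1 : ContDiffAt ℝ ∞ f u := hf.contDiffAt (hU.mem_nhds hu)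
  have h2 : DifferentiableAt ℝ (fderiv ℝ f) u :=
    (h1.fderiv_right (m := 1) (by norm_cast)).differentiableAt (by simp)
  have h3 : IsSymmSndFDerivAt ℝ f u := h1.isSymmSndFDerivAt (by simp; norm_cast)
  have h4 : ∀ i j : Fin N, pd i (pd j f) u =
      fderiv ℝ (fderiv ℝ f) u (Pi.single i 1) (Pi.single j 1) := fun i j => by
    have := (h2.hasFDerivAt.clm_apply (hasFDerivAt_const (Pi.single j (1 : ℝ)) u)).fderiv
    unfold pd
    rw [this]
    simp
  rw [h4, h4, h3]

theorem pd_congr (hU : IsOpen U) {f g : (Fin N → ℝ) → E} (h : EqOn f g U) (hu : u ∈ U)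
    (i : Fin N) : pd i f u = pd i g u := by
  unfold pd
  rw [(h.eventuallyEq_of_mem (hU.mem_nhds hu)).fderiv_eq]

theorem pd_const (c : E) (i : Fin N) : pd i (fun _ => c) u = 0 := by simp [pd]

theorem pd_add {f g : (Fin N → ℝ) → E} (hf : DifferentiableAt ℝ f u)
    (hg : DifferentiableAt ℝ g u) (i : Fin N) :
    pd i (fun v => f v + g v) u = pd i f u + pd i g u := by
  simp [pd, fderiv_fun_add hf hg]

theorem pd_sub {f g : (Fin N → ℝ) → E} (hf : DifferentiableAt ℝ f u)
    (hg : DifferentiableAt ℝ g u) (i : Fin N) :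
    pd i (fun v => f v - g v) u = pd i f u - pd i g u := by
  simp [pd, fderiv_fun_sub hf hg]

theorem pd_sum {κ : Type*} {s : Finset κ} {f : κ → (Fin N → ℝ) → E}
    (hf : ∀ k ∈ s, DifferentiableAt ℝ (f k) u) (i : Fin N) :
    pd i (fun v => ∑ k ∈ s, f k v) u = ∑ k ∈ s, pd i (f k) u := by
  simp [pd, fderiv_fun_sum hf]

theorem pd_mul {f g : (Fin N → ℝ) → ℝ} (hf : DifferentiableAt ℝ f u)
    (hg : DifferentiableAt ℝ g u) (i : Fin N) :
    pd i (fun v => f v * g v) u = pd i f u * g u + f u * pd i g u := by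
  simp [pd, fderiv_fun_mul hf hg]; ring

theorem pd_clm_comp {E' : Type*} [NormedAddCommGroup E'] [NormedSpace ℝ E'] (T : E →L[ℝ] E')
    {f : (Fin N → ℝ) → E} (hf : DifferentiableAt ℝ f u) (i : Fin N) :
    pd i (fun v => T (f v)) u = T (pd i f u) := by
  have := (T.hasFDerivAt.comp u hf.hasFDerivAt).fderiv
  unfold pd
  rw [show (fun v => T (f v)) = T ∘ f from rfl, this]
  rfl

theorem pd_apply {κ : Type*} [Fintype κ] {f : (Fin N → ℝ) → κ → ℝ} (hf : DifferentiableAt ℝ f u)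
    (i : Fin N) (k : κ) : pd i (fun v => f v k) u = pd i f u k :=
  pd_clm_comp (ContinuousLinearMap.proj (R := ℝ) (φ := fun _ : κ => ℝ) k) hf i

theorem eqOn_const_of_pd_eq_zero (hU : IsOpen U) (hUc : IsPreconnected U) {f : (Fin N → ℝ) → E}
    (hf : ContDiffOn ℝ ∞ f U) (h : ∀ v ∈ U, ∀ i, pd i f v = 0) {v w : Fin N → ℝ} (hv : v ∈ U)
    (hw : w ∈ U) : f v = f w := by
  refine hU.is_const_of_fderiv_eq_zero (𝕜 := ℝ) hUc
    (fun x hx => (differentiableAt_of_contDiffOn hU hf hx).differentiableWithinAt)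
    (fun x hx => ?_) hv hw
  ext1 y
  rw [fderiv_apply_eq_sum_pd]
  simp [h x hx]

end PartialDerivatives

/-! ### Flat matrix systems and the Poincaré lemma. -/

section Integration

variable {N : ℕ} {U : Set (Fin N → ℝ)}

theorem exists_coordinate_solution {𝔸 : Type*} [NormedRing 𝔸] [NormedAlgebra ℝ 𝔸] [CompleteSpace 𝔸]
    (hU : IsOpen U) (hUs : IsSimplyConnected U) (Ω : Fin N → (Fin N → ℝ) → 𝔸)
    (hΩ : ∀ i, ContDiffOn ℝ ∞ (Ω i) U)
    (hflat : ∀ u ∈ U, ∀ i j, pd i (Ω j) u + Ω i u * Ω j u = pd j (Ω i) u + Ω j u * Ω i u)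
    {x₀ : Fin N → ℝ} (hx₀ : x₀ ∈ U) :
    ∃ F : (Fin N → ℝ) → 𝔸ˣ, F x₀ = 1 ∧ ContDiffOn ℝ ∞ (fun u => (F u : 𝔸)) U ∧
      ∀ u ∈ U, ∀ i, pd i (fun v => (F v : 𝔸)) u = F u * Ω i u := by
  -- `e i M` is the form M du^i, so that A below is the sum of the forms Ω_i du^i.
  let e : Fin N → 𝔸 →L[ℝ] (Fin N → ℝ) →L[ℝ] 𝔸 := fun i =>
    ContinuousLinearMap.smulRightL ℝ _ _ (ContinuousLinearMap.proj (φ := fun _ : Fin N => ℝ) i)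
  have he : ∀ i M h, e i M h = h i • M := fun i M h => rfl
  let A : (Fin N → ℝ) → (Fin N → ℝ) →L[ℝ] 𝔸 := fun u => ∑ i, e i (Ω i u)
  have hAapp : ∀ u h, A u h = ∑ i, h i • Ω i u := fun u h => by simp [A, he]
  have hA : ContDiffOn ℝ ∞ A U :=
    ContDiffOn.sum fun i _ => (e i).contDiff.comp_contDiffOn (hΩ i)
  have hdΩ : ∀ u ∈ U, ∀ i, DifferentiableAt ℝ (Ω i) u := fun u hu i =>
    differentiableAt_of_contDiffOn hU (hΩ i) hu
  have hdA : ∀ u ∈ U, ∀ v w, fderiv ℝ A u v w = ∑ i, ∑ j, (v i * w j) • pd i (Ω j) u := by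
    intro u hu v w
    have h1 : HasFDerivAt A (∑ i, (e i).comp (fderiv ℝ (Ω i) u)) u :=
      HasFDerivAt.fun_sum fun i _ => (e i).hasFDerivAt.comp u (hdΩ u hu i).hasFDerivAt
    rw [h1.fderiv, Finset.sum_comm]
    simp [he, fderiv_apply_eq_sum_pd, smul_smul]
  have hAA : ∀ u v w, A u v * A u w = ∑ i, ∑ j, (v i * w j) • (Ω i u * Ω j u) := fun u v w => by
    simp [hAapp, Finset.sum_mul_sum, smul_smul, mul_comm]
  obtain ⟨F, hF0, hF⟩ := exists_global_solution hU hUs hA (fun u hu v w => by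
    rw [hdA u hu, hdA u hu, hAA, hAA, ← Finset.sum_add_distrib, ← Finset.sum_add_distrib]
    simp_rw [← Finset.sum_add_distrib, ← smul_add]
    rw [Finset.sum_comm]
    refine Finset.sum_congr rfl fun i _ => Finset.sum_congr rfl fun j _ => ?_
    rw [hflat u hu, mul_comm]) hx₀
  refine ⟨F, hF0, SolvesPfaffian.contDiffOn hU hA hF, fun u hu i => ?_⟩
  rw [pd, (hF u hu).fderiv]
  simp [hAapp, Pi.single_apply]

/-- Smoothness and derivatives of matrices are stated entry by entry, which keeps norms on matrices
out of the statement; φ transports the problem to a normed algebra, where the integration takes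
place. -/
theorem exists_algEquiv_solution {𝔸 ι : Type*} [Fintype ι] [DecidableEq ι] [NormedRing 𝔸]
    [NormedAlgebra ℝ 𝔸] [FiniteDimensional ℝ 𝔸] (φ : 𝔸 ≃ₐ[ℝ] Matrix ι ι ℝ) (hU : IsOpen U)
    (hUs : IsSimplyConnected U) (Ω : Fin N → (Fin N → ℝ) → Matrix ι ι ℝ)
    (hΩ : ∀ i k l, ContDiffOn ℝ ∞ (fun u => Ω i u k l) U)
    (hflat : ∀ u ∈ U, ∀ i j k l, pd i (fun v => Ω j v k l) u + (Ω i u * Ω j u) k l =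
      pd j (fun v => Ω i v k l) u + (Ω j u * Ω i u) k l) {x₀ : Fin N → ℝ} (hx₀ : x₀ ∈ U) :
    ∃ F : (Fin N → ℝ) → Matrix ι ι ℝ, F x₀ = 1 ∧ (∀ k l, ContDiffOn ℝ ∞ (fun u => F u k l) U) ∧
      (∀ u, IsUnit (F u)) ∧
      ∀ u ∈ U, ∀ i k l, pd i (fun v => F v k l) u = (F u * Ω i u) k l := by
  have : CompleteSpace 𝔸 := FiniteDimensional.complete ℝ _
  let entry : ι → ι → 𝔸 →L[ℝ] ℝ := fun k l =>
    ((Matrix.entryLinearMap ℝ ℝ k l).comp φ.toLinearMap).toContinuousLinearMap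
  have hentry : ∀ k l M, entry k l M = φ M k l := fun k l M => rfl
  let Ω' : Fin N → (Fin N → ℝ) → 𝔸 := fun i u => φ.symm (Ω i u)
  have hΩs : ∀ i, ContDiffOn ℝ ∞ (Ω' i) U := by
    intro i
    have : Ω' i = fun u => ∑ k, ∑ l, Ω i u k l • φ.symm (Matrix.single k l (1 : ℝ)) := by
      funext u
      simp only [Ω']
      conv_lhs => rw [Matrix.matrix_eq_sum_single (Ω i u)]
      simp_rw [← map_smul, ← map_sum]
      simp
    rw [this]
    exact ContDiffOn.sum fun k _ => ContDiffOn.sum fun l _ => (hΩ i k l).smul contDiffOn_const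
  have hdΩ : ∀ u ∈ U, ∀ i, DifferentiableAt ℝ (Ω' i) u := fun u hu i =>
    differentiableAt_of_contDiffOn hU (hΩs i) hu
  have hpdΩ : ∀ u ∈ U, ∀ i j k l, pd i (fun v => Ω j v k l) u = φ (pd i (Ω' j) u) k l := by
    intro u hu i j k l
    rw [← hentry, ← pd_clm_comp _ (hdΩ u hu j)]
    simp [hentry, Ω']
  obtain ⟨F, hF0, hFs, hF⟩ := exists_coordinate_solution hU hUs Ω' hΩs (fun u hu i j => by
    refine φ.injective ?_
    ext k l
    have := hflat u hu i j k l
    rw [hpdΩ u hu, hpdΩ u hu] at this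
    simpa [Ω'] using this) hx₀
  refine ⟨fun u => φ (F u), by simp [hF0], fun k l => (entry k l).contDiff.comp_contDiffOn hFs,
    fun u => (F u).isUnit.map φ, fun u hu i k l => ?_⟩
  have := pd_clm_comp (entry k l) (differentiableAt_of_contDiffOn hU hFs hu) i
  rw [hF u hu] at this
  simpa [hentry, Ω'] using this

/-- The matrix equation `∂_i F = F Ω_i` with flat `Ω` is solvable on simply connected domains. -/
theorem exists_matrix_solution {ι : Type*} [Fintype ι] [DecidableEq ι] (hU : IsOpen U)
    (hUs : IsSimplyConnected U) (Ω : Fin N → (Fin N → ℝ) → Matrix ι ι ℝ)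
    (hΩ : ∀ i k l, ContDiffOn ℝ ∞ (fun u => Ω i u k l) U)
    (hflat : ∀ u ∈ U, ∀ i j k l, pd i (fun v => Ω j v k l) u + (Ω i u * Ω j u) k l =
      pd j (fun v => Ω i v k l) u + (Ω j u * Ω i u) k l) {x₀ : Fin N → ℝ} (hx₀ : x₀ ∈ U) :
    ∃ F : (Fin N → ℝ) → Matrix ι ι ℝ, F x₀ = 1 ∧ (∀ k l, ContDiffOn ℝ ∞ (fun u => F u k l) U) ∧
      (∀ u, IsUnit (F u)) ∧
      ∀ u ∈ U, ∀ i k l, pd i (fun v => F v k l) u = (F u * Ω i u) k l := by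
  let _ : NormedRing (Matrix ι ι ℝ) := Matrix.linftyOpNormedRing
  let _ : NormedAlgebra ℝ (Matrix ι ι ℝ) := Matrix.linftyOpNormedAlgebra
  exact exists_algEquiv_solution (𝔸 := Matrix ι ι ℝ) AlgEquiv.refl hU hUs Ω hΩ hflat hx₀

/-- The Poincaré lemma for closed `1`-forms on simply connected domains. -/
theorem exists_potential (hU : IsOpen U) (hUs : IsSimplyConnected U)
    (w : Fin N → (Fin N → ℝ) → ℝ) (hw : ∀ i, ContDiffOn ℝ ∞ (w i) U)
    (hclosed : ∀ u ∈ U, ∀ i j, pd i (w j) u = pd j (w i) u) :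
    ∃ f : (Fin N → ℝ) → ℝ, ContDiffOn ℝ ∞ f U ∧ ∀ u ∈ U, ∀ i, pd i f u = w i u := by
  obtain ⟨x₀, hx₀⟩ := hUs.nonempty
  -- For 1×1 matrices the products commute and flatness is closedness. The solution F never
  -- vanishes, and log |F| is the potential (`Real.log` ignores the sign).
  obtain ⟨F, -, hFs, hFu, hF⟩ := exists_matrix_solution (ι := Unit) hU hUs
    (fun i u => Matrix.of fun _ _ => w i u) (fun i _ _ => hw i)
    (fun u hu i j k l => by simp [hclosed u hu i j, Matrix.mul_apply, mul_comm]) hx₀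
  have hne : ∀ u, F u () () ≠ 0 := fun u h => by
    have := (Matrix.isUnit_iff_isUnit_det _).1 (hFu u)
    rw [Matrix.det_unique] at this
    exact this.ne_zero h
  refine ⟨fun u => Real.log (F u () ()), (hFs () ()).log fun u _ => hne u, fun u hu i => ?_⟩
  have h1 := (differentiableAt_of_contDiffOn hU (hFs () ()) hu).hasFDerivAt.log (hne u)
  have h2 := hF u hu i () ()
  rw [pd] at h2
  rw [pd, h1.fderiv]
  simp [h2, Matrix.mul_apply, hne u]

theorem exists_vector_potential {κ : Type*} [Fintype κ] (hU : IsOpen U)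
    (hUs : IsSimplyConnected U) (w : Fin N → (Fin N → ℝ) → κ → ℝ)
    (hw : ∀ i, ContDiffOn ℝ ∞ (w i) U)
    (hclosed : ∀ u ∈ U, ∀ i j, pd i (w j) u = pd j (w i) u) :
    ∃ f : (Fin N → ℝ) → κ → ℝ, ContDiffOn ℝ ∞ f U ∧ ∀ u ∈ U, ∀ i, pd i f u = w i u := by
  have hwd := fun i u hu => differentiableAt_of_contDiffOn (u := u) hU (hw i) hu
  have : ∀ k, ∃ f : (Fin N → ℝ) → ℝ, ContDiffOn ℝ ∞ f U ∧ ∀ u ∈ U, ∀ i, pd i f u = w i u k :=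
    fun k => exists_potential hU hUs (fun i u => w i u k) (fun i => contDiffOn_pi.1 (hw i) k)
      fun u hu i j => by rw [pd_apply (hwd j u hu), pd_apply (hwd i u hu), hclosed u hu]
  choose f hf hfw using this
  have hfs : ContDiffOn ℝ ∞ (fun u k => f k u) U := contDiffOn_pi.2 hf
  refine ⟨fun u k => f k u, hfs, fun u hu i => ?_⟩
  ext k
  rw [← pd_apply (differentiableAt_of_contDiffOn hU hfs hu), hfw k u hu i]

end Integration

/-! ### Signatures and Sylvester's law of inertia. -/

section Signature

open Matrix

variable {ι κ : Type*} [Fintype ι] [Fintype κ] [DecidableEq ι] [DecidableEq κ]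

/-- The scalar squares of the standard basis of the pseudo-Euclidean space. -/
def signWeights (p q : ℕ) : Fin p ⊕ Fin q → ℝ := Sum.elim (fun _ => 1) (fun _ => -1)

theorem pseudoInner_eq {p q : ℕ} (x y : PseudoEuclidean p q) :
    pseudoInner x y = ∑ a, signWeights p q a * x a * y a := by
  simp [pseudoInner, signWeights, sub_eq_add_neg]

theorem signWeights_mul_self {p q : ℕ} (a : Fin p ⊕ Fin q) :
    signWeights p q a * signWeights p q a = 1 := by
  cases a <;> simp [signWeights]

theorem gram_apply {ι κ : Type*} [Fintype κ] [DecidableEq κ] (M : Matrix κ ι ℝ) (w : κ → ℝ) (i j : ι) :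
    (Mᵀ * diagonal w * M) i j = ∑ a, w a * M a i * M a j := by
  rw [mul_apply]
  refine Finset.sum_congr rfl fun a _ => ?_
  rw [mul_diagonal, transpose_apply]
  ring

theorem gram_signWeights_apply {ι : Type*} {p q : ℕ} (M : Matrix (Fin p ⊕ Fin q) ι ℝ) (i j : ι) :
    (Mᵀ * diagonal (signWeights p q) * M) i j = pseudoInner (M.col i) (M.col j) := by
  rw [gram_apply, pseudoInner_eq]
  rfl

theorem ncard_pos_sumElim {m n : ℕ} (v : Fin m → ℝ) (w : Fin n → ℝ) :
    {i | 0 < Sum.elim v w i}.ncard = {i | 0 < v i}.ncard + {i | 0 < w i}.ncard := by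
  rw [show {i | 0 < Sum.elim v w i} = Sum.inl '' {i | 0 < v i} ∪ Sum.inr '' {i | 0 < w i} by
    ext i; cases i <;> simp, ncard_union_eq (by
      rw [disjoint_left]; rintro _ ⟨a, _, rfl⟩ ⟨b, _, h⟩; cases h),
    ncard_image_of_injective _ Sum.inl_injective, ncard_image_of_injective _ Sum.inr_injective]

theorem ncard_neg_sumElim {m n : ℕ} (v : Fin m → ℝ) (w : Fin n → ℝ) :
    {i | Sum.elim v w i < 0}.ncard = {i | v i < 0}.ncard + {i | w i < 0}.ncard := by
  rw [show {i | Sum.elim v w i < 0} = Sum.inl '' {i | v i < 0} ∪ Sum.inr '' {i | w i < 0} by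
    ext i; cases i <;> simp, ncard_union_eq (by
      rw [disjoint_left]; rintro _ ⟨a, _, rfl⟩ ⟨b, _, h⟩; cases h),
    ncard_image_of_injective _ Sum.inl_injective, ncard_image_of_injective _ Sum.inr_injective]

theorem ncard_pos_signWeights (p q : ℕ) : {i | 0 < signWeights p q i}.ncard = p := by
  rw [signWeights, ncard_pos_sumElim]
  simp [ncard_univ, show ¬ (0 : ℝ) < -1 by norm_num]

theorem ncard_neg_signWeights (p q : ℕ) : {i | signWeights p q i < 0}.ncard = q := by
  rw [signWeights, ncard_neg_sumElim]
  simp [ncard_univ, show ¬ (1 : ℝ) < 0 by norm_num]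

theorem exists_congruent_diagonal {A : Matrix ι ι ℝ} (hA : A.IsSymm) :
    ∃ (w : ι → ℝ) (Q R : Matrix ι ι ℝ), Q * R = 1 ∧ R * Q = 1 ∧ Qᵀ * diagonal w * Q = A := by
  have hH : A.IsHermitian := by rwa [IsHermitian, conjTranspose_eq_transpose_of_trivial]
  have hs := hH.spectral_theorem
  rw [Unitary.conjStarAlgAut_apply] at hs
  set V : Matrix ι ι ℝ := (hH.eigenvectorUnitary : Matrix ι ι ℝ) with hV
  have hVt : star V = Vᵀ := conjTranspose_eq_transpose_of_trivial V
  refine ⟨hH.eigenvalues, Vᵀ, V, ?_, ?_, ?_⟩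
  · rw [← hVt]; exact Unitary.coe_star_mul_self hH.eigenvectorUnitary
  · rw [← hVt]; exact Unitary.coe_mul_star_self hH.eigenvectorUnitary
  · rw [transpose_transpose]
    conv_rhs => rw [hs]
    rw [← hVt]
    rfl

theorem equivalent_weightedSumSquares_of_congruent {A : Matrix ι ι ℝ} {w : κ → ℝ}
    {Q : Matrix κ ι ℝ} {R : Matrix ι κ ℝ} (hQR : Q * R = 1) (hRQ : R * Q = 1)
    (hA : Qᵀ * diagonal w * Q = A) :
    QuadraticMap.Equivalent A.toQuadraticForm' (QuadraticMap.weightedSumSquares ℝ w) := by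
  let e : (ι → ℝ) ≃ₗ[ℝ] (κ → ℝ) := LinearEquiv.ofLinearMap (toLin' Q) (toLin' R)
    (by rw [← toLin'_mul, hQR, toLin'_one]) (by rw [← toLin'_mul, hRQ, toLin'_one])
  refine ⟨⟨e, fun x => ?_⟩⟩
  change QuadraticMap.weightedSumSquares ℝ w (Q *ᵥ x) = _
  rw [QuadraticMap.weightedSumSquares_apply, Matrix.toQuadraticForm',
    LinearMap.BilinMap.toQuadraticMap_apply, toLinearMap₂'_apply', ← hA, ← mulVec_mulVec,
    ← mulVec_mulVec, dotProduct_mulVec, vecMul_transpose, dotProduct]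
  refine Finset.sum_congr rfl fun i _ => ?_
  rw [mulVec_diagonal, smul_eq_mul]
  ring

/-- Sylvester's law. The index types of Q may differ, so a frame matrix can itself serve as the
congruence. -/
theorem sigPos_of_congruent {A : Matrix ι ι ℝ} {w : κ → ℝ}
    {Q : Matrix κ ι ℝ} {R : Matrix ι κ ℝ} (hQR : Q * R = 1) (hRQ : R * Q = 1)
    (hA : Qᵀ * diagonal w * Q = A) : sigPos A.toQuadraticForm' = {i | 0 < w i}.ncard :=
  QuadraticForm.sigPos_of_equiv_weightedSumSquares
    (equivalent_weightedSumSquares_of_congruent hQR hRQ hA)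

theorem sigNeg_of_congruent {A : Matrix ι ι ℝ} {w : κ → ℝ}
    {Q : Matrix κ ι ℝ} {R : Matrix ι κ ℝ} (hQR : Q * R = 1) (hRQ : R * Q = 1)
    (hA : Qᵀ * diagonal w * Q = A) : sigNeg A.toQuadraticForm' = {i | w i < 0}.ncard :=
  QuadraticForm.sigNeg_of_equiv_weightedSumSquares
    (equivalent_weightedSumSquares_of_congruent hQR hRQ hA)

/-- A block diagonal form is congruent to a diagonal one with the total signature. -/
theorem exists_congruent_block {N L : ℕ} {η : Matrix (Fin N) (Fin N) ℝ}
    {μ : Matrix (Fin L) (Fin L) ℝ} (hη : η.IsSymm) (hμ : μ.IsSymm) :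
    ∃ (w : Fin N ⊕ Fin L → ℝ) (Q R : Matrix (Fin N ⊕ Fin L) (Fin N ⊕ Fin L) ℝ),
      Q * R = 1 ∧ R * Q = 1 ∧ Qᵀ * diagonal w * Q = fromBlocks η 0 0 μ ∧
      signature η + signature μ = ({i | 0 < w i}.ncard, {i | w i < 0}.ncard) := by
  obtain ⟨w₁, Q₁, R₁, h₁, h₁', hA₁⟩ := exists_congruent_diagonal hη
  obtain ⟨w₂, Q₂, R₂, h₂, h₂', hA₂⟩ := exists_congruent_diagonal hμ
  refine ⟨Sum.elim w₁ w₂, fromBlocks Q₁ 0 0 Q₂, fromBlocks R₁ 0 0 R₂, ?_, ?_, ?_, ?_⟩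
  · simp [fromBlocks_multiply, h₁, h₂]
  · simp [fromBlocks_multiply, h₁', h₂']
  · rw [show diagonal (Sum.elim w₁ w₂) = fromBlocks (diagonal w₁) 0 0 (diagonal w₂) by
      rw [fromBlocks_diagonal], fromBlocks_transpose, fromBlocks_multiply, fromBlocks_multiply]
    simp [hA₁, hA₂]
  · rw [ncard_pos_sumElim, ncard_neg_sumElim, signature, signature,
      sigPos_of_congruent h₁ h₁' hA₁, sigPos_of_congruent h₂ h₂' hA₂,
      sigNeg_of_congruent h₁ h₁' hA₁, sigNeg_of_congruent h₂ h₂' hA₂]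
    rfl

theorem det_fromBlocks_ne_zero {N L : ℕ} {η : Matrix (Fin N) (Fin N) ℝ}
    {μ : Matrix (Fin L) (Fin L) ℝ} (hη : η.det ≠ 0) (hμ : μ.det ≠ 0) :
    (fromBlocks η 0 0 μ).det ≠ 0 := by
  rw [det_fromBlocks_zero₂₁]
  exact mul_ne_zero hη hμ

/-- M is invertible because p + q = N + L, so it is a congruence between diag(η, μ) and the form of
E. Comparing it with a separate diagonalization of η and μ gives the signatures. -/
theorem signature_eq_of_gram {N L p q : ℕ} (hpq : p + q = N + L)
    {η : Matrix (Fin N) (Fin N) ℝ} {μ : Matrix (Fin L) (Fin L) ℝ} (hη : IsMetricMatrix η)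
    (hμ : IsMetricMatrix μ) {M : Matrix (Fin p ⊕ Fin q) (Fin N ⊕ Fin L) ℝ}
    (hM : Mᵀ * diagonal (signWeights p q) * M = fromBlocks η 0 0 μ) :
    (p, q) = signature η + signature μ := by
  obtain ⟨w, Q, R, h, h', hw, hsig⟩ := exists_congruent_block hη.1 hμ.1
  have hdet : IsUnit (fromBlocks η 0 0 μ).det := (det_fromBlocks_ne_zero hη.2 hμ.2).isUnit
  have hXM : (fromBlocks η 0 0 μ)⁻¹ * Mᵀ * diagonal (signWeights p q) * M = 1 := by
    rw [Matrix.mul_assoc, Matrix.mul_assoc, ← Matrix.mul_assoc Mᵀ, hM, nonsing_inv_mul _ hdet]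
  have hMX := (mul_eq_one_comm_of_equiv (Fintype.equivOfCardEq (by simp [hpq]))).1 hXM
  have e1 := sigPos_of_congruent hMX hXM hM
  have e2 := sigNeg_of_congruent hMX hXM hM
  rw [sigPos_of_congruent h h' hw, ncard_pos_signWeights] at e1
  rw [sigNeg_of_congruent h h' hw, ncard_neg_signWeights] at e2
  rw [hsig, e1, e2]

/-- The i-th column of P is √|w i| times a standard basis vector of E of the same sign as w i; the
counts p and q make such a matching possible. -/
theorem exists_gram_eq_diagonal {p q : ℕ} {w : ι → ℝ} (hw : ∀ i, w i ≠ 0)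
    (hp : {i | 0 < w i}.ncard = p) (hq : {i | w i < 0}.ncard = q) :
    ∃ P : Matrix (Fin p ⊕ Fin q) ι ℝ, Pᵀ * diagonal (signWeights p q) * P = diagonal w := by
  have hq' : {i | ¬ 0 < w i}.ncard = q := by
    rw [← hq]
    congr 1
    ext i
    exact ⟨fun h => lt_of_le_of_ne (not_lt.1 h) (hw i), fun h => not_lt.2 (le_of_lt h)⟩
  rw [← Nat.card_coe_set_eq] at hp hq'
  let e₁ : Fin p ≃ {i // 0 < w i} := (Finite.equivFinOfCardEq hp).symm
  let e₂ : Fin q ≃ {i // ¬ 0 < w i} := (Finite.equivFinOfCardEq hq').symm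
  let e : Fin p ⊕ Fin q ≃ ι := (e₁.sumCongr e₂).trans (Equiv.sumCompl fun i => 0 < w i)
  have he : ∀ a, signWeights p q a * |w (e a)| = w (e a) := by
    rintro (a | a)
    · have : 0 < w (e (Sum.inl a)) := (e₁ a).2
      simp [signWeights, abs_of_pos this]
    · have : w (e (Sum.inr a)) ≤ 0 := not_lt.1 (e₂ a).2
      simp [signWeights, abs_of_nonpos this]
  refine ⟨of fun a i => if e a = i then √|w i| else 0, ?_⟩
  ext i j
  obtain ⟨a, rfl⟩ := e.surjective i
  rw [gram_apply, Finset.sum_eq_single a (fun b _ hb => by simp [e.injective.eq_iff, hb])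
    (by simp), diagonal_apply]
  simp only [of_apply, if_true]
  split_ifs with h
  · rw [← h, mul_assoc, Real.mul_self_sqrt (abs_nonneg _), he]
  · simp

/-- The converse of `signature_eq_of_gram`; it supplies the initial frame for the reconstruction of
a submanifold. -/
theorem exists_gram_eq_block {N L p q : ℕ}
    {η : Matrix (Fin N) (Fin N) ℝ} {μ : Matrix (Fin L) (Fin L) ℝ} (hη : IsMetricMatrix η)
    (hμ : IsMetricMatrix μ) (hsig : (p, q) = signature η + signature μ) :
    ∃ P : Matrix (Fin p ⊕ Fin q) (Fin N ⊕ Fin L) ℝ,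
      Pᵀ * diagonal (signWeights p q) * P = fromBlocks η 0 0 μ := by
  obtain ⟨w, Q, R, h, h', hw, hs⟩ := exists_congruent_block hη.1 hμ.1
  rw [hs, Prod.mk.injEq] at hsig
  have hne : ∀ i, w i ≠ 0 := by
    have := det_fromBlocks_ne_zero hη.2 hμ.2
    rw [← hw, det_mul, det_mul, det_diagonal] at this
    exact fun i => Finset.prod_ne_zero_iff.1 (right_ne_zero_of_mul (left_ne_zero_of_mul this)) i
      (Finset.mem_univ i)
  obtain ⟨P, hP⟩ := exists_gram_eq_diagonal hne hsig.1.symm hsig.2.symm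
  refine ⟨P * Q, ?_⟩
  rw [← hw, ← hP, transpose_mul]
  simp only [Matrix.mul_assoc]

end Signature

/-! ### The scalar product and its derivatives. -/

section PseudoInner

variable {p q : ℕ}

theorem pseudoInner_comm (x y : PseudoEuclidean p q) : pseudoInner x y = pseudoInner y x := by
  simp [pseudoInner, mul_comm]

/-- The scalar product as a continuous bilinear map. -/
noncomputable def pseudoInnerL (p q : ℕ) : PseudoEuclidean p q →L[ℝ] PseudoEuclidean p q →L[ℝ] ℝ :=
  ∑ a, signWeights p q a • (ContinuousLinearMap.mul ℝ ℝ).bilinearComp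
    (ContinuousLinearMap.proj (φ := fun _ : Fin p ⊕ Fin q => ℝ) a)
    (ContinuousLinearMap.proj (φ := fun _ : Fin p ⊕ Fin q => ℝ) a)

theorem pseudoInnerL_apply (x y : PseudoEuclidean p q) :
    pseudoInnerL p q x y = pseudoInner x y := by
  simp [pseudoInnerL, pseudoInner_eq, mul_assoc, -Fintype.sum_sum_type]

theorem pseudoInner_sum_left {κ : Type*} (s : Finset κ) (c : κ → ℝ) (f : κ → PseudoEuclidean p q)
    (y : PseudoEuclidean p q) :
    pseudoInner (∑ k ∈ s, c k • f k) y = ∑ k ∈ s, c k * pseudoInner (f k) y := by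
  simp [← pseudoInnerL_apply]

theorem pseudoInner_sum_right {κ : Type*} (s : Finset κ) (c : κ → ℝ)
    (f : κ → PseudoEuclidean p q) (y : PseudoEuclidean p q) :
    pseudoInner y (∑ k ∈ s, c k • f k) = ∑ k ∈ s, c k * pseudoInner y (f k) := by
  simp [← pseudoInnerL_apply]

theorem pseudoInner_zero_left (y : PseudoEuclidean p q) : pseudoInner 0 y = 0 := by
  simp [← pseudoInnerL_apply]

theorem pseudoInner_zero_right (y : PseudoEuclidean p q) : pseudoInner y 0 = 0 := by
  simp [← pseudoInnerL_apply]

theorem pseudoInner_add_left (x x' y : PseudoEuclidean p q) :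
    pseudoInner (x + x') y = pseudoInner x y + pseudoInner x' y := by
  simp [← pseudoInnerL_apply]

theorem pseudoInner_single (x : PseudoEuclidean p q) (a : Fin p ⊕ Fin q) :
    pseudoInner x (Pi.single a 1) = signWeights p q a * x a := by
  rw [pseudoInner_eq, Finset.sum_eq_single a (fun b _ hb => by simp [hb]) (by simp)]
  simp

theorem eq_zero_of_forall_pseudoInner {x : PseudoEuclidean p q}
    (h : ∀ y, pseudoInner x y = 0) : x = 0 := by
  ext a
  have := h (Pi.single a 1)
  rw [pseudoInner_single] at this
  rcases mul_eq_zero.1 this with h' | h'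
  · have := signWeights_mul_self a
    simp [h'] at this
  · exact h'

variable {N : ℕ} {U : Set (Fin N → ℝ)} {u : Fin N → ℝ}

theorem contDiffOn_pseudoInner {f g : (Fin N → ℝ) → PseudoEuclidean p q}
    (hf : ContDiffOn ℝ ∞ f U) (hg : ContDiffOn ℝ ∞ g U) :
    ContDiffOn ℝ ∞ (fun v => pseudoInner (f v) (g v)) U := by
  simp_rw [← pseudoInnerL_apply]
  exact ((pseudoInnerL p q).contDiff.comp_contDiffOn hf).clm_apply hg

theorem pd_pseudoInner {f g : (Fin N → ℝ) → PseudoEuclidean p q} (hf : DifferentiableAt ℝ f u)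
    (hg : DifferentiableAt ℝ g u) (i : Fin N) :
    pd i (fun v => pseudoInner (f v) (g v)) u =
      pseudoInner (pd i f u) (g u) + pseudoInner (f u) (pd i g u) := by
  simp_rw [← pseudoInnerL_apply]
  have h := (((pseudoInnerL p q).hasFDerivAt.comp u hf.hasFDerivAt).clm_apply
    hg.hasFDerivAt).fderiv
  unfold pd
  simp only [Function.comp_def] at h
  rw [h]
  simp [add_comm]

theorem pd_pseudoInner_eq_zero (hU : IsOpen U) {f g : (Fin N → ℝ) → PseudoEuclidean p q} {c : ℝ}
    (hf : ContDiffOn ℝ ∞ f U) (hg : ContDiffOn ℝ ∞ g U)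
    (h : ∀ v ∈ U, pseudoInner (f v) (g v) = c) (hu : u ∈ U) (i : Fin N) :
    pseudoInner (pd i f u) (g u) + pseudoInner (f u) (pd i g u) = 0 := by
  rw [← pd_pseudoInner (differentiableAt_of_contDiffOn hU hf hu)
    (differentiableAt_of_contDiffOn hU hg hu), pd_congr hU h hu, pd_const]

end PseudoInner

/-! ### Linear algebra of frames with Gram matrix diag(η, μ). -/

section Frames

open Matrix

variable {N L p q : ℕ} {η : Matrix (Fin N) (Fin N) ℝ} {μ : Matrix (Fin L) (Fin L) ℝ}
  {M : Matrix (Fin p ⊕ Fin q) (Fin N ⊕ Fin L) ℝ}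

theorem fromBlocks_inv_mul (hη : η.det ≠ 0) (hμ : μ.det ≠ 0) :
    fromBlocks η⁻¹ 0 0 μ⁻¹ * fromBlocks η 0 0 μ = 1 := by
  rw [fromBlocks_multiply]
  simp [nonsing_inv_mul _ hη.isUnit, nonsing_inv_mul _ hμ.isUnit]

theorem gram_left_inverse (hη : η.det ≠ 0) (hμ : μ.det ≠ 0)
    (hM : Mᵀ * diagonal (signWeights p q) * M = fromBlocks η 0 0 μ) :
    fromBlocks η⁻¹ 0 0 μ⁻¹ * Mᵀ * diagonal (signWeights p q) * M = 1 := by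
  rw [Matrix.mul_assoc, Matrix.mul_assoc, ← Matrix.mul_assoc Mᵀ, hM, fromBlocks_inv_mul hη hμ]

/-- Completeness relation of a frame: as p + q = N + L, the left inverse built from the Gram matrix
is also a right inverse. -/
theorem gram_right_inverse (hpq : p + q = N + L) (hη : η.det ≠ 0) (hμ : μ.det ≠ 0)
    (hM : Mᵀ * diagonal (signWeights p q) * M = fromBlocks η 0 0 μ) :
    M * fromBlocks η⁻¹ 0 0 μ⁻¹ * Mᵀ * diagonal (signWeights p q) = 1 := by
  have := (mul_eq_one_comm_of_equiv (Fintype.equivOfCardEq (by simp [hpq]))).1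
    (gram_left_inverse hη hμ hM)
  simpa only [Matrix.mul_assoc] using this

/-- The completeness relation contains M only through M S Mᵀ, the product that stays constant along
solutions of the frame equations. This lemma recovers the Gram relations from it. -/
theorem gram_of_right_inverse (hpq : p + q = N + L) (hη : η.det ≠ 0) (hμ : μ.det ≠ 0)
    (hM : M * fromBlocks η⁻¹ 0 0 μ⁻¹ * Mᵀ * diagonal (signWeights p q) = 1) :
    Mᵀ * diagonal (signWeights p q) * M = fromBlocks η 0 0 μ := by
  rw [Matrix.mul_assoc, Matrix.mul_assoc] at hM
  have h1 := (mul_eq_one_comm_of_equiv (Fintype.equivOfCardEq (by simp [hpq]))).1 hM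
  have h2 := congrArg (fromBlocks η 0 0 μ * ·) h1
  simp only [Matrix.mul_one] at h2
  rw [← h2, ← Matrix.mul_assoc, ← Matrix.mul_assoc,
    mul_eq_one_comm.1 (fromBlocks_inv_mul hη hμ), Matrix.one_mul]

theorem gram_eq_iff : Mᵀ * diagonal (signWeights p q) * M = fromBlocks η 0 0 μ ↔
    (∀ i j, pseudoInner (M.col (Sum.inl i)) (M.col (Sum.inl j)) = η i j) ∧
    (∀ α i, pseudoInner (M.col (Sum.inr α)) (M.col (Sum.inl i)) = 0) ∧
    ∀ α β, pseudoInner (M.col (Sum.inr α)) (M.col (Sum.inr β)) = μ α β := by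
  constructor
  · intro h
    refine ⟨fun i j => ?_, fun α i => ?_, fun α β => ?_⟩ <;>
    rw [← gram_signWeights_apply, h] <;> simp
  · rintro ⟨h1, h2, h3⟩
    ext c d
    rw [gram_signWeights_apply]
    rcases c with c | c <;> rcases d with d | d
    · simpa using h1 c d
    · rw [pseudoInner_comm]; simpa using h2 d c
    · simpa using h2 c d
    · simpa using h3 c d

/-- The expansion of a vector in a frame. -/
theorem eq_sum_of_gram (hpq : p + q = N + L) (hη : η.det ≠ 0) (hμ : μ.det ≠ 0)
    (hM : Mᵀ * diagonal (signWeights p q) * M = fromBlocks η 0 0 μ) (x : PseudoEuclidean p q) :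
    x = (∑ i, (∑ j, η⁻¹ i j * pseudoInner x (M.col (Sum.inl j))) • M.col (Sum.inl i)) +
      ∑ α, (∑ β, μ⁻¹ α β * pseudoInner x (M.col (Sum.inr β))) • M.col (Sum.inr α) := by
  have h1 : (Mᵀ * diagonal (signWeights p q)) *ᵥ x = fun c => pseudoInner x (M.col c) := by
    ext c
    rw [mulVec, dotProduct, pseudoInner_eq]
    refine Finset.sum_congr rfl fun a _ => ?_
    rw [mul_diagonal, transpose_apply, col_apply]
    ring
  have h2 := congrArg (· *ᵥ x) (gram_right_inverse hpq hη hμ hM)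
  simp only [one_mulVec] at h2
  rw [Matrix.mul_assoc, ← mulVec_mulVec, h1, ← mulVec_mulVec] at h2
  conv_lhs => rw [← h2]
  ext a
  simp [mulVec, dotProduct, Fintype.sum_sum_type, mul_comm]

theorem pseudoInner_eq_sum_of_gram (hpq : p + q = N + L) (hη : η.det ≠ 0) (hμ : μ.det ≠ 0)
    (hM : Mᵀ * diagonal (signWeights p q) * M = fromBlocks η 0 0 μ) (x y : PseudoEuclidean p q) :
    pseudoInner x y =
      (∑ i, ∑ j, η⁻¹ i j *
        (pseudoInner y (M.col (Sum.inl i)) * pseudoInner x (M.col (Sum.inl j)))) +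
      ∑ α, ∑ β, μ⁻¹ α β *
        (pseudoInner y (M.col (Sum.inr α)) * pseudoInner x (M.col (Sum.inr β))) := by
  conv_lhs => rw [eq_sum_of_gram hpq hη hμ hM x]
  rw [pseudoInner_add_left, pseudoInner_sum_left, pseudoInner_sum_left]
  simp_rw [Finset.sum_mul, pseudoInner_comm y]
  congr 1 <;>
  exact Finset.sum_congr rfl fun _ _ => Finset.sum_congr rfl fun _ _ => by ring

theorem linearIndependent_of_gram (hη : η.det ≠ 0) (hμ : μ.det ≠ 0)
    (hM : Mᵀ * diagonal (signWeights p q) * M = fromBlocks η 0 0 μ) :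
    LinearIndependent ℝ M.col := by
  rw [← mulVec_injective_iff]
  intro v w h
  have := congrArg (fun x => (fromBlocks η⁻¹ 0 0 μ⁻¹ * Mᵀ * diagonal (signWeights p q)) *ᵥ x) h
  simpa [mulVec_mulVec, gram_left_inverse hη hμ hM] using this

/-- The Gram matrix of a frame of the normal space of a nonisotropic subspace is nondegenerate. -/
theorem det_ne_zero_of_gram (hpq : p + q = N + L) (hη : η.det ≠ 0)
    (hM : Mᵀ * diagonal (signWeights p q) * M = fromBlocks η 0 0 μ)
    (hn : LinearIndependent ℝ fun α => M.col (Sum.inr α)) : μ.det ≠ 0 := by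
  obtain ⟨h1, h2, h3⟩ := gram_eq_iff.1 hM
  have h1' : ∀ i j, pseudoInner (M.col (Sum.inl i)) (M.col (Sum.inl j)) = η j i := fun i j => by
    rw [pseudoInner_comm, h1]
  have h3' : ∀ α β, pseudoInner (M.col (Sum.inr α)) (M.col (Sum.inr β)) = μ β α := fun α β => by
    rw [pseudoInner_comm, h3]
  have hinj : ∀ v, η *ᵥ v = 0 → v = 0 := fun v hv => by
    by_contra hne
    exact hη (exists_mulVec_eq_zero_iff.1 ⟨v, hne, hv⟩)
  -- Pairing a relation with the tangent columns kills its tangential coefficients, because η is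
  -- nondegenerate; the rest is a relation among the normals.
  have hLI : LinearIndependent ℝ M.col := by
    rw [Fintype.linearIndependent_iff]
    intro g hg
    rw [Fintype.sum_sum_type] at hg
    have hl : (fun i => g (Sum.inl i)) = 0 := by
      refine hinj _ ?_
      ext j
      have := congrArg (fun x => pseudoInner x (M.col (Sum.inl j))) hg
      simp only [pseudoInner_add_left, pseudoInner_sum_left, h2, pseudoInner_zero_left] at this
      simp_rw [h1'] at this
      simpa [mulVec, dotProduct, mul_comm] using this
    have hl' : ∀ i, g (Sum.inl i) = 0 := fun i => congrFun hl i
    simp only [hl', zero_smul, Finset.sum_const_zero, zero_add] at hg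
    rintro (i | α)
    · exact hl' i
    · exact Fintype.linearIndependent_iff.1 hn _ hg α
  have htop : Submodule.span ℝ (Set.range M.col) = ⊤ :=
    hLI.span_eq_top_of_card_eq_finrank' (by simp [hpq])
  intro hdet
  obtain ⟨v, hv, hμv⟩ := exists_mulVec_eq_zero_iff.2 hdet
  -- A null vector of μ yields a normal vector orthogonal to the whole frame, hence to all of E.
  have hz : ∑ α, v α • M.col (Sum.inr α) = 0 := by
    refine eq_zero_of_forall_pseudoInner fun y => ?_
    have hy : y ∈ Submodule.span ℝ (Set.range M.col) := htop ▸ Submodule.mem_top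
    induction hy using Submodule.span_induction with
    | mem y hy =>
      obtain ⟨c, rfl⟩ := hy
      rw [pseudoInner_sum_left]
      rcases c with i | β
      · simp [h2]
      · simp_rw [h3']
        simpa [mulVec, dotProduct, mul_comm] using congrFun hμv β
    | zero => exact pseudoInner_zero_right _
    | add y z _ _ hy hz => rw [pseudoInner_comm, pseudoInner_add_left, pseudoInner_comm y,
        pseudoInner_comm z, hy, hz, add_zero]
    | smul c y _ hy =>
      rw [← pseudoInnerL_apply, map_smul, pseudoInnerL_apply, hy, smul_zero]
  exact hv (funext (Fintype.linearIndependent_iff.1 hn v hz))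

end Frames

open Matrix

/-! ### From a submanifold to a solution: the equations of Gauss, Codazzi and Ricci. -/

section FundamentalForms

variable {N L p q : ℕ} {U : Set (Fin N → ℝ)} {r : (Fin N → ℝ) → PseudoEuclidean p q}
  {n : Fin L → (Fin N → ℝ) → PseudoEuclidean p q} {η : Matrix (Fin N) (Fin N) ℝ}
  {μ : Matrix (Fin L) (Fin L) ℝ} {u : Fin N → ℝ}

/-- The matrix whose columns are the tangent vectors `r_{uⁱ}` and the normal vectors `n_α`. -/
noncomputable def frameMatrix (r : (Fin N → ℝ) → PseudoEuclidean p q)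
    (n : Fin L → (Fin N → ℝ) → PseudoEuclidean p q) (u : Fin N → ℝ) :
    Matrix (Fin p ⊕ Fin q) (Fin N ⊕ Fin L) ℝ :=
  Matrix.of fun a c => Sum.elim (fun i => pd i r u a) (fun α => n α u a) c

theorem frameMatrix_col_inl (i : Fin N) : (frameMatrix r n u).col (Sum.inl i) = pd i r u := rfl

theorem frameMatrix_col_inr (α : Fin L) : (frameMatrix r n u).col (Sum.inr α) = n α u := rfl

theorem frameMatrix_gram (hη : firstForm r u = η) (hn : IsNormalFrame U r μ n) (hu : u ∈ U) :
    (frameMatrix r n u)ᵀ * diagonal (signWeights p q) * frameMatrix r n u =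
      fromBlocks η 0 0 μ :=
  gram_eq_iff.2 ⟨fun i j => by rw [← hη]; rfl, hn.normal u hu, hn.gram u hu⟩

theorem firstForm_isSymm : (firstForm r u).IsSymm := by
  ext i j
  exact pseudoInner_comm _ _

theorem isMetricMatrix_of_flatCoordinates (hUne : U.Nonempty) (hr : IsNonisotropicSubmanifold U r)
    (hη : IsFlatCoordinates U r η) : IsMetricMatrix η := by
  obtain ⟨u, hu⟩ := hUne
  rw [← hη u hu]
  exact ⟨firstForm_isSymm, hr.nonisotropic u hu⟩

theorem isMetricMatrix_of_normalFrame (hpq : p + q = N + L) (hUne : U.Nonempty)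
    (hr : IsNonisotropicSubmanifold U r) (hn : IsNormalFrame U r μ n) : IsMetricMatrix μ := by
  obtain ⟨u, hu⟩ := hUne
  refine ⟨?_, ?_⟩
  · ext α β
    rw [transpose_apply, ← hn.gram u hu, ← hn.gram u hu, pseudoInner_comm]
  · exact det_ne_zero_of_gram hpq (hr.nonisotropic u hu) (frameMatrix_gram rfl hn hu)
      (hn.linearIndependent u hu)

section SecondOrder

variable (hU : IsOpen U) (hr : ContDiffOn ℝ ∞ r U)
include hU hr

theorem secondForm_isSymm (hu : u ∈ U) (α : Fin L) (i j : Fin N) :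
    secondForm r n α u i j = secondForm r n α u j i := by
  simp only [secondForm, of_apply]
  rw [pd_comm hU hr hu]

theorem secondForm_contDiffOn (hn : IsNormalFrame U r μ n) (α : Fin L) (i j : Fin N) :
    ContDiffOn ℝ ∞ (fun u => secondForm r n α u i j) U :=
  contDiffOn_pseudoInner (hn.smooth α) (contDiffOn_pd hU (contDiffOn_pd hU hr j) i)

/-- In flat coordinates the second derivatives of the radius vector are normal. -/
theorem pseudoInner_pd_pd_pd (hη : IsFlatCoordinates U r η) (hu : u ∈ U) (i j k : Fin N) :
    pseudoInner (pd i (pd j r) u) (pd k r u) = 0 := by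
  -- Differentiating the constant (r_j, r_k) gives antisymmetry in j, k; with the symmetry in i, j
  -- the expression vanishes.
  have key : ∀ i j k, pseudoInner (pd i (pd j r) u) (pd k r u) =
      - pseudoInner (pd i (pd k r) u) (pd j r u) := fun i j k => by
    have := pd_pseudoInner_eq_zero hU (contDiffOn_pd hU hr j) (contDiffOn_pd hU hr k) (c := η j k)
      (fun v hv => by rw [← hη v hv]; rfl) hu i
    rw [pseudoInner_comm (pd j r u)] at this
    linarith
  have h1 := key i j k
  have h2 := key k i j
  have h3 := key j k i
  rw [pd_comm hU hr hu k i] at h2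
  rw [pd_comm hU hr hu j k, pd_comm hU hr hu j i] at h3
  linarith

/-- The tangential part of the derivatives of the normals. -/
theorem pseudoInner_pd_normal_pd (hn : IsNormalFrame U r μ n) (hu : u ∈ U) (α : Fin L)
    (i j : Fin N) :
    pseudoInner (pd i (n α) u) (pd j r u) = - secondForm r n α u i j := by
  have := pd_pseudoInner_eq_zero hU (hn.smooth α) (contDiffOn_pd hU hr j)
    (fun v hv => hn.normal v hv α j) hu i
  simp only [secondForm, of_apply]
  linarith

variable (hpq : p + q = N + L) (hη : IsFlatCoordinates U r η) (hηd : η.det ≠ 0) (hμd : μ.det ≠ 0)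
  (hn : IsTorsionlessFrame U r μ n)
include hpq hη hηd hμd hn

/-- The Gauss decomposition in flat coordinates. -/
theorem pd_pd_eq (hu : u ∈ U) (i j : Fin N) :
    pd i (pd j r) u = ∑ α, (∑ β, μ⁻¹ α β * secondForm r n β u i j) • n α u := by
  conv_lhs => rw [eq_sum_of_gram hpq hηd hμd (frameMatrix_gram (hη u hu) hn.1 hu)
    (pd i (pd j r) u)]
  simp only [frameMatrix_col_inl, frameMatrix_col_inr, pseudoInner_pd_pd_pd hU hr hη hu, mul_zero,
    Finset.sum_const_zero, zero_smul, zero_add]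
  simp only [secondForm, of_apply, pseudoInner_comm (pd i (pd j r) u)]

/-- The Weingarten decomposition for a torsionless frame. -/
theorem pd_normal_eq (hu : u ∈ U) (α : Fin L) (i : Fin N) :
    pd i (n α) u = ∑ k, (-∑ j, η⁻¹ k j * secondForm r n α u i j) • pd k r u := by
  have ht : ∀ β, pseudoInner (pd i (n α) u) (n β u) = 0 := fun β => hn.2 u hu α β i
  conv_lhs => rw [eq_sum_of_gram hpq hηd hμd (frameMatrix_gram (hη u hu) hn.1 hu) (pd i (n α) u)]
  simp only [frameMatrix_col_inl, frameMatrix_col_inr, ht,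
    pseudoInner_pd_normal_pd hU hr hn.1 hu, mul_zero,
    Finset.sum_const_zero, zero_smul, add_zero, mul_neg, Finset.sum_neg_distrib]

/-- The Codazzi equations. -/
theorem pd_secondForm (hu : u ∈ U) (α : Fin L) (i j k : Fin N) :
    pd k (fun v => secondForm r n α v i j) u = pd i (fun v => secondForm r n α v k j) u := by
  have hj := contDiffOn_pd hU hr j
  -- The other term of the product rule, (∂_k n_α, r_ij), vanishes: r_ij is a combination of the
  -- normals, and the torsion is zero. What is left is symmetric in i, k.
  have key : ∀ i k, pd k (fun v => secondForm r n α v i j) u =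
      pseudoInner (n α u) (pd k (pd i (pd j r)) u) := fun i k => by
    have h1 : (fun v => secondForm r n α v i j) =
      fun v => pseudoInner (n α v) (pd i (pd j r) v) := rfl
    rw [h1, pd_pseudoInner (differentiableAt_of_contDiffOn hU (hn.1.smooth α) hu)
      (differentiableAt_of_contDiffOn hU (contDiffOn_pd hU hj i) hu),
      pd_pd_eq hU hr hpq hη hηd hμd hn hu, pseudoInner_sum_right]
    have ht : ∀ β, pseudoInner (pd k (n α) u) (n β u) = 0 := fun β => hn.2 u hu α β k
    simp [ht]
  rw [key, key, pd_comm hU hj hu]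

/-- Differentiating (r_ik, r_j) = 0 gives (r_ik, r_jl) = -(r_ikl, r_j), which is symmetric in k, l.
Expanding the left side in the normals gives the Gauss expression. -/
theorem gauss_secondForm (hu : u ∈ U) (i j k l : Fin N) :
    ∑ α, ∑ β, μ⁻¹ α β * (secondForm r n α u i k * secondForm r n β u j l -
      secondForm r n α u i l * secondForm r n β u j k) = 0 := by
  have hpair : ∀ i j k l, pseudoInner (pd j (pd l r) u) (pd i (pd k r) u) =
      ∑ α, ∑ β, μ⁻¹ α β * (secondForm r n α u i k * secondForm r n β u j l) :=
    fun i j k l => by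
      rw [pseudoInner_eq_sum_of_gram hpq hηd hμd (frameMatrix_gram (hη u hu) hn.1 hu)]
      simp only [frameMatrix_col_inl, frameMatrix_col_inr, pseudoInner_pd_pd_pd hU hr hη hu,
        mul_zero, Finset.sum_const_zero, zero_add]
      simp only [secondForm, of_apply, pseudoInner_comm (n _ u)]
  have hdiff : ∀ i j k l, pseudoInner (pd i (pd k r) u) (pd j (pd l r) u) =
      - pseudoInner (pd l (pd i (pd k r)) u) (pd j r u) := fun i j k l => by
    have := pd_pseudoInner_eq_zero hU (contDiffOn_pd hU (contDiffOn_pd hU hr k) i)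
      (contDiffOn_pd hU hr j) (fun v hv => pseudoInner_pd_pd_pd hU hr hη hv i k j) hu l
    rw [pd_comm hU hr hu l j] at this
    linarith
  have hthird : pd l (pd i (pd k r)) u = pd k (pd i (pd l r)) u := by
    rw [pd_comm hU (contDiffOn_pd hU hr k) hu, pd_congr hU (fun v hv => pd_comm hU hr hv l k) hu,
      ← pd_comm hU (contDiffOn_pd hU hr l) hu i k, pd_comm hU (contDiffOn_pd hU hr l) hu]
  have h1 := hdiff i j k l
  have h2 := hdiff i j l k
  rw [hthird, ← h2, pseudoInner_comm, hpair, pseudoInner_comm, hpair] at h1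
  simp_rw [mul_sub, Finset.sum_sub_distrib]
  rw [h1, sub_self]

/-- Differentiating the zero torsion (∂_k n_α, n_β) gives (∂_k n_α, ∂_l n_β) = -(∂_l ∂_k n_α, n_β),
which is symmetric in k, l. The left side is expanded in the tangent vectors. -/
theorem ricci_secondForm (hu : u ∈ U) (α β : Fin L) (k l : Fin N) :
    ∑ i, ∑ j, η⁻¹ i j * (secondForm r n α u i k * secondForm r n β u j l -
      secondForm r n α u i l * secondForm r n β u j k) = 0 := by
  have hpair : ∀ k l, pseudoInner (pd l (n β) u) (pd k (n α) u) =
      ∑ i, ∑ j, η⁻¹ i j * (secondForm r n α u i k * secondForm r n β u j l) := fun k l => by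
    have ht : ∀ β, pseudoInner (pd k (n α) u) (n β u) = 0 := fun β => hn.2 u hu α β k
    rw [pseudoInner_eq_sum_of_gram hpq hηd hμd (frameMatrix_gram (hη u hu) hn.1 hu)]
    simp only [frameMatrix_col_inl, frameMatrix_col_inr, ht, zero_mul,
      mul_zero, Finset.sum_const_zero, add_zero, pseudoInner_pd_normal_pd hU hr hn.1 hu, neg_mul_neg,
      secondForm_isSymm hU hr hu _ k, secondForm_isSymm hU hr hu _ l]
  have hdiff : ∀ k l, pseudoInner (pd k (n α) u) (pd l (n β) u) =
      - pseudoInner (pd l (pd k (n α)) u) (n β u) := fun k l => by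
    have := pd_pseudoInner_eq_zero hU (contDiffOn_pd hU (hn.1.smooth α) k)
      (hn.1.smooth β) (fun v hv => hn.2 v hv α β k) hu l
    linarith
  have h1 := hdiff k l
  have h2 := hdiff l k
  rw [pd_comm hU (hn.1.smooth α) hu, ← h2, pseudoInner_comm, hpair, pseudoInner_comm, hpair] at h1
  simp_rw [mul_sub, Finset.sum_sub_distrib]
  rw [h1, sub_self]

end SecondOrder

/-- The Poincaré lemma is used twice: closedness integrates each column of w to some φ_j, and the
symmetry of w makes the φ_j a closed form, whose potential is f. -/
theorem exists_hessian_eq (hU : IsOpen U) (hUs : IsSimplyConnected U)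
    (w : Fin N → Fin N → (Fin N → ℝ) → ℝ) (hw : ∀ i j, ContDiffOn ℝ ∞ (w i j) U)
    (hsymm : ∀ u ∈ U, ∀ i j, w i j u = w j i u)
    (hclosed : ∀ u ∈ U, ∀ i j k, pd k (w i j) u = pd i (w k j) u) :
    ∃ f : (Fin N → ℝ) → ℝ, ContDiffOn ℝ ∞ f U ∧ ∀ u ∈ U, hessian f u = of fun i j => w i j u := by
  have : ∀ j, ∃ f : (Fin N → ℝ) → ℝ, ContDiffOn ℝ ∞ f U ∧ ∀ u ∈ U, ∀ i, pd i f u = w i j u :=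
    fun j => exists_potential hU hUs (fun i => w i j) (fun i => hw i j)
      fun u hu i k => hclosed u hu k j i
  choose φ hφ hφw using this
  obtain ⟨f, hf, hfφ⟩ := exists_potential hU hUs φ hφ
    fun u hu i j => by rw [hφw _ u hu, hφw _ u hu, hsymm u hu]
  refine ⟨f, hf, fun u hu => ?_⟩
  ext i j
  simp only [hessian, of_apply]
  rw [pd_congr hU (fun v hv => hfφ v hv j) hu, hφw j u hu]

theorem pd_coordinate (i j : Fin N) : pd i (fun v : Fin N → ℝ => v j) u = if j = i then 1 else 0 := by
  have : pd i (fun v : Fin N → ℝ => v) u = Pi.single i 1 := by simp [pd]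
  rw [pd_apply (f := fun v : Fin N → ℝ => v) differentiableAt_fun_id, this, Pi.single_apply]

theorem pd_linear (i : Fin N) (a : Fin N → ℝ) : pd i (fun v : Fin N → ℝ => ∑ j, a j * v j) u = a i := by
  rw [pd_sum fun j _ => by fun_prop]
  have : ∀ j, pd i (fun v : Fin N → ℝ => a j * v j) u = if j = i then a j else 0 := fun j => by
    rw [pd_mul (differentiableAt_const _) (by fun_prop), pd_const, pd_coordinate]
    simp
  simp [this]

/-- Two functions on a connected domain have equal Hessians if and only if they differ by an
affine function. -/
theorem hessian_eq_iff (hU : IsOpen U) (hUc : IsPreconnected U) (hUne : U.Nonempty)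
    {f g : (Fin N → ℝ) → ℝ} (hf : ContDiffOn ℝ ∞ f U) (hg : ContDiffOn ℝ ∞ g U) :
    (∀ u ∈ U, hessian g u = hessian f u) ↔
      ∃ (a : Fin N → ℝ) (c : ℝ), ∀ u ∈ U, g u = f u + ∑ i, a i * u i + c := by
  have hlin : ∀ a : Fin N → ℝ, ContDiffOn ℝ ∞ (fun v : Fin N → ℝ => ∑ j, a j * v j) U :=
    fun a => by fun_prop
  constructor
  · intro h
    obtain ⟨x, hx⟩ := hUne
    have h1 : ∀ j, ∀ u ∈ U, pd j g u - pd j f u = pd j g x - pd j f x := fun j u hu => by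
      refine eqOn_const_of_pd_eq_zero hU hUc (f := fun v => pd j g v - pd j f v)
        ((contDiffOn_pd hU hg j).sub (contDiffOn_pd hU hf j)) (fun v hv i => ?_) hu hx
      rw [pd_sub (differentiableAt_of_contDiffOn hU (contDiffOn_pd hU hg j) hv)
        (differentiableAt_of_contDiffOn hU (contDiffOn_pd hU hf j) hv)]
      have := congrFun (congrFun (h v hv) i) j
      simp only [hessian, of_apply] at this
      rw [this, sub_self]
    set a : Fin N → ℝ := fun j => pd j g x - pd j f x with ha
    refine ⟨a, g x - f x - ∑ j, a j * x j, fun u hu => ?_⟩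
    have := eqOn_const_of_pd_eq_zero hU hUc (f := fun v => g v - f v - ∑ j, a j * v j)
        ((hg.sub hf).sub (hlin a)) (fun v hv i => ?_) hu hx
    · linarith
    · have dg := differentiableAt_of_contDiffOn hU hg hv
      have df := differentiableAt_of_contDiffOn hU hf hv
      rw [pd_sub (dg.fun_sub df) (differentiableAt_of_contDiffOn hU (hlin a) hv), pd_sub dg df,
        pd_linear, h1 i v hv, ha, sub_self]
  · rintro ⟨a, c, h⟩ u hu
    have h1 : ∀ j, ∀ v ∈ U, pd j g v = pd j f v + a j := fun j v hv => by
      have df := differentiableAt_of_contDiffOn hU hf hv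
      have dl := differentiableAt_of_contDiffOn hU (hlin a) hv
      rw [pd_congr hU h hv, pd_add (df.fun_add dl) (differentiableAt_const _), pd_add df dl,
        pd_linear, pd_const, add_zero]
    ext i j
    simp only [hessian, of_apply]
    rw [pd_congr hU (h1 j) hu, pd_add (differentiableAt_of_contDiffOn hU (contDiffOn_pd hU hf j) hu)
      (differentiableAt_const _), pd_const, add_zero]

theorem exists_solution_of_flatTorsionless (hpq : p + q = N + L) (hU : IsOpen U)
    (hUs : IsSimplyConnected U) (hr : IsFlatTorsionless L U r) (hη : IsFlatCoordinates U r η)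
    (hn : IsTorsionlessFrame U r μ n) :
    IsMetricMatrix η ∧ IsMetricMatrix μ ∧ (p, q) = signature η + signature μ ∧
      ∃ ψ : Fin L → (Fin N → ℝ) → ℝ, IsSolution U η μ ψ ∧ Realizes U η μ ψ r n ∧
        ∀ ψ' : Fin L → (Fin N → ℝ) → ℝ, (∀ α, ContDiffOn ℝ ∞ (ψ' α) U) →
          (Realizes U η μ ψ' r n ↔
            ∃ (a : Fin L → Fin N → ℝ) (c : Fin L → ℝ), ∀ α, ∀ u ∈ U,
              ψ' α u = ψ α u + ∑ i, a α i * u i + c α) := by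
  have hUne := hUs.nonempty
  have hUc := hUs.isPathConnected.isConnected.isPreconnected
  have hηm := isMetricMatrix_of_flatCoordinates hUne hr.1 hη
  have hμm := isMetricMatrix_of_normalFrame hpq hUne hr.1 hn.1
  have hrs := hr.1.smooth
  have hex : ∀ α, ∃ f : (Fin N → ℝ) → ℝ, ContDiffOn ℝ ∞ f U ∧
      ∀ u ∈ U, hessian f u = secondForm r n α u := fun α =>
    exists_hessian_eq hU hUs (fun i j u => secondForm r n α u i j)
      (fun i j => secondForm_contDiffOn hU hrs hn.1 α i j)
      (fun u hu i j => secondForm_isSymm hU hrs hu α i j)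
      (fun u hu i j k => pd_secondForm hU hrs hpq hη hηm.2 hμm.2 hn hu α i j k)
  choose ψ hψ hψh using hex
  refine ⟨hηm, hμm, ?_, ψ, ⟨hψ, fun u hu i j k l => ?_, fun u hu α β k l => ?_⟩,
    ⟨hr, hη, hn, fun u hu α => (hψh α u hu).symm⟩, fun ψ' hψ' => ?_⟩
  · obtain ⟨u, hu⟩ := hUne
    exact signature_eq_of_gram hpq hηm hμm (frameMatrix_gram (hη u hu) hn.1 hu)
  · simp_rw [hψh _ u hu]
    exact gauss_secondForm hU hrs hpq hη hηm.2 hμm.2 hn hu i j k l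
  · simp_rw [hψh _ u hu]
    exact ricci_secondForm hU hrs hpq hη hηm.2 hμm.2 hn hu α β k l
  · have h1 : Realizes U η μ ψ' r n ↔ ∀ α, ∀ u ∈ U, hessian (ψ' α) u = hessian (ψ α) u :=
      ⟨fun h α u hu => by rw [hψh α u hu, h.secondForm_eq u hu α],
        fun h => ⟨hr, hη, hn, fun u hu α => by rw [h α u hu, hψh α u hu]⟩⟩
    rw [h1]
    simp_rw [hessian_eq_iff hU hUc hUne (hψ _) (hψ' _)]
    constructor
    · intro h
      choose a c hac using h
      exact ⟨a, c, hac⟩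
    · rintro ⟨a, c, h⟩ α
      exact ⟨a α, c α, h α⟩

end FundamentalForms

/-! ### Entrywise calculus of matrix fields. -/

section MatrixCalculus

variable {N : ℕ} {U : Set (Fin N → ℝ)} {u : Fin N → ℝ} {κ κ' ι : Type*} [Fintype ι]

/-- The entrywise partial derivative of a matrix field. -/
noncomputable def matrixPd (i : Fin N) (F : (Fin N → ℝ) → Matrix κ ι ℝ) (u : Fin N → ℝ) :
    Matrix κ ι ℝ :=
  of fun k l => pd i (fun v => F v k l) u

theorem matrixPd_mul {F : (Fin N → ℝ) → Matrix κ ι ℝ} {G : (Fin N → ℝ) → Matrix ι κ' ℝ}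
    (hF : ∀ k l, DifferentiableAt ℝ (fun v => F v k l) u)
    (hG : ∀ k l, DifferentiableAt ℝ (fun v => G v k l) u) (i : Fin N) :
    matrixPd i (fun v => F v * G v) u = matrixPd i F u * G u + F u * matrixPd i G u := by
  ext k l
  simp only [matrixPd, of_apply, mul_apply, Matrix.add_apply]
  rw [pd_sum fun m _ => (hF k m).fun_mul (hG m l), ← Finset.sum_add_distrib]
  exact Finset.sum_congr rfl fun m _ => pd_mul (hF k m) (hG m l) i

theorem contDiffOn_matrix_mul {F : (Fin N → ℝ) → Matrix κ ι ℝ} {G : (Fin N → ℝ) → Matrix ι κ' ℝ}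
    (hF : ∀ k l, ContDiffOn ℝ ∞ (fun v => F v k l) U)
    (hG : ∀ k l, ContDiffOn ℝ ∞ (fun v => G v k l) U) (k : κ) (l : κ') :
    ContDiffOn ℝ ∞ (fun v => (F v * G v) k l) U := by
  simp only [mul_apply]
  exact ContDiffOn.sum fun m _ => (hF k m).mul (hG m l)

/-- If `F`, `F'` solve `∂_i F = F Ω_i` and `S` solves `∂_i S = -(Ω_i S + S Ω_iᵀ)` then
`F' S Fᵀ` is constant. -/
theorem mul_mul_transpose_const (hU : IsOpen U) (hUc : IsPreconnected U)
    {Ω : Fin N → (Fin N → ℝ) → Matrix ι ι ℝ} {F : (Fin N → ℝ) → Matrix κ ι ℝ}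
    {F' : (Fin N → ℝ) → Matrix κ' ι ℝ} {S : (Fin N → ℝ) → Matrix ι ι ℝ}
    (hFs : ∀ k l, ContDiffOn ℝ ∞ (fun v => F v k l) U)
    (hF's : ∀ k l, ContDiffOn ℝ ∞ (fun v => F' v k l) U)
    (hSs : ∀ k l, ContDiffOn ℝ ∞ (fun v => S v k l) U)
    (hF : ∀ u ∈ U, ∀ i, matrixPd i F u = F u * Ω i u)
    (hF' : ∀ u ∈ U, ∀ i, matrixPd i F' u = F' u * Ω i u)
    (hS : ∀ u ∈ U, ∀ i, matrixPd i S u = -(Ω i u * S u + S u * (Ω i u)ᵀ))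
    {v w : Fin N → ℝ} (hv : v ∈ U) (hw : w ∈ U) :
    F' v * S v * (F v)ᵀ = F' w * S w * (F w)ᵀ := by
  have hFt : ∀ k l, ContDiffOn ℝ ∞ (fun v => (F v)ᵀ k l) U := fun k l => hFs l k
  have hFS := contDiffOn_matrix_mul hF's hSs
  ext k l
  refine eqOn_const_of_pd_eq_zero hU hUc (f := fun v => (F' v * S v * (F v)ᵀ) k l)
    (contDiffOn_matrix_mul hFS hFt k l) (fun u hu i => ?_) hv hw
  have hFt' : matrixPd i (fun v => (F v)ᵀ) u = (matrixPd i F u)ᵀ := rfl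
  have : matrixPd i (fun v => F' v * S v * (F v)ᵀ) u = 0 := by
    rw [matrixPd_mul
      (fun k l => differentiableAt_of_contDiffOn hU (hFS k l) hu)
      (fun k l => differentiableAt_of_contDiffOn hU (hFt k l) hu), matrixPd_mul
      (fun k l => differentiableAt_of_contDiffOn hU (hF's k l) hu)
      (fun k l => differentiableAt_of_contDiffOn hU (hSs k l) hu), hFt', hF u hu, hF' u hu, hS u hu,
      transpose_mul]
    simp only [Matrix.mul_neg, Matrix.mul_add, Matrix.add_mul, Matrix.neg_mul, Matrix.mul_assoc]
    abel
  exact congrFun (congrFun this k) l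

end MatrixCalculus

/-! ### From a solution to a submanifold, and uniqueness up to motions. -/

section GaussWeingarten

variable {N L p q : ℕ} {U : Set (Fin N → ℝ)} {r : (Fin N → ℝ) → PseudoEuclidean p q}
  {n : Fin L → (Fin N → ℝ) → PseudoEuclidean p q} {η : Matrix (Fin N) (Fin N) ℝ}
  {μ : Matrix (Fin L) (Fin L) ℝ} {ψ : Fin L → (Fin N → ℝ) → ℝ} {u : Fin N → ℝ}

/-- The `i`-th rows of the Hessians. -/
noncomputable def hessianRows (ψ : Fin L → (Fin N → ℝ) → ℝ) (i : Fin N) (u : Fin N → ℝ) :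
    Matrix (Fin L) (Fin N) ℝ :=
  of fun α j => hessian (ψ α) u i j

/-- The coefficients of the Gauss–Weingarten equations. -/
noncomputable def gaussWeingarten (η : Matrix (Fin N) (Fin N) ℝ) (μ : Matrix (Fin L) (Fin L) ℝ)
    (ψ : Fin L → (Fin N → ℝ) → ℝ) (i : Fin N) (u : Fin N → ℝ) :
    Matrix (Fin N ⊕ Fin L) (Fin N ⊕ Fin L) ℝ :=
  fromBlocks 0 (-(η⁻¹ * (hessianRows ψ i u)ᵀ)) (μ⁻¹ * hessianRows ψ i u) 0

/-- The coefficients lie in the Lie algebra of the group preserving the inverse block metric; this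
makes F S Fᵀ constant. -/
theorem gaussWeingarten_metric (hη : η.IsSymm) (hμ : μ.IsSymm) (i : Fin N) :
    gaussWeingarten η μ ψ i u * fromBlocks η⁻¹ 0 0 μ⁻¹ +
      fromBlocks η⁻¹ 0 0 μ⁻¹ * (gaussWeingarten η μ ψ i u)ᵀ = 0 := by
  have hη' : η⁻¹ᵀ = η⁻¹ := by rw [transpose_nonsing_inv, hη.eq]
  have hμ' : μ⁻¹ᵀ = μ⁻¹ := by rw [transpose_nonsing_inv, hμ.eq]
  rw [gaussWeingarten, fromBlocks_transpose, fromBlocks_multiply, fromBlocks_multiply,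
    fromBlocks_add]
  simp [hη', hμ', Matrix.mul_assoc]

theorem hessian_symm (hU : IsOpen U) {f : (Fin N → ℝ) → ℝ} (hf : ContDiffOn ℝ ∞ f U) (hu : u ∈ U)
    (i j : Fin N) : hessian f u i j = hessian f u j i := pd_comm hU hf hu i j

theorem contDiffOn_hessian (hU : IsOpen U) {f : (Fin N → ℝ) → ℝ} (hf : ContDiffOn ℝ ∞ f U)
    (i j : Fin N) : ContDiffOn ℝ ∞ (fun u => hessian f u i j) U :=
  contDiffOn_pd hU (contDiffOn_pd hU hf j) i

theorem pd_hessian (hU : IsOpen U) {f : (Fin N → ℝ) → ℝ} (hf : ContDiffOn ℝ ∞ f U) (hu : u ∈ U)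
    (i j k : Fin N) : pd i (fun v => hessian f v j k) u = pd j (fun v => hessian f v i k) u :=
  pd_comm hU (contDiffOn_pd hU hf k) hu i j

theorem gaussWeingarten_smooth (hU : IsOpen U) (hψ : ∀ α, ContDiffOn ℝ ∞ (ψ α) U) (i : Fin N)
    (c d : Fin N ⊕ Fin L) : ContDiffOn ℝ ∞ (fun u => gaussWeingarten η μ ψ i u c d) U := by
  rcases c with c | c <;> rcases d with d | d
  · exact contDiffOn_const
  · exact (contDiffOn_matrix_mul (F := fun _ => η⁻¹) (G := fun u => (hessianRows ψ i u)ᵀ)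
      (fun _ _ => contDiffOn_const) (fun j α => contDiffOn_hessian hU (hψ α) i j) c d).neg
  · exact contDiffOn_matrix_mul (F := fun _ => μ⁻¹) (G := fun u => hessianRows ψ i u)
      (fun _ _ => contDiffOn_const) (fun α j => contDiffOn_hessian hU (hψ α) i j) c d
  · exact contDiffOn_const

theorem matrixPd_const_mul {κ ι κ' : Type*} [Fintype ι] (C : Matrix κ ι ℝ)
    {F : (Fin N → ℝ) → Matrix ι κ' ℝ}
    (hF : ∀ k l, DifferentiableAt ℝ (fun v => F v k l) u) (i : Fin N) :
    matrixPd i (fun v => C * F v) u = C * matrixPd i F u := by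
  rw [matrixPd_mul (F := fun _ => C) (fun _ _ => differentiableAt_const _) hF]
  have : matrixPd i (fun _ : Fin N → ℝ => C) u = 0 := by
    ext k l
    exact pd_const _ _
  rw [this, Matrix.zero_mul, zero_add]

/-- The Codazzi half of compatibility, automatic for Hessians by the symmetry of third derivatives.
-/
theorem gaussWeingarten_closed (hU : IsOpen U) (hψ : ∀ α, ContDiffOn ℝ ∞ (ψ α) U) (hu : u ∈ U)
    (i j : Fin N) : matrixPd i (gaussWeingarten η μ ψ j) u = matrixPd j (gaussWeingarten η μ ψ i) u := by
  have hW : ∀ i j, matrixPd i (hessianRows ψ j) u = matrixPd j (hessianRows ψ i) u := fun i j => by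
    ext α k
    exact pd_hessian hU (hψ α) hu i j k
  have hd : ∀ i α k, DifferentiableAt ℝ (fun v => hessianRows ψ i v α k) u := fun i α k =>
    differentiableAt_of_contDiffOn hU (contDiffOn_hessian hU (hψ α) i k) hu
  have key : ∀ i j, matrixPd i (gaussWeingarten η μ ψ j) u =
      fromBlocks 0 (-(η⁻¹ * (matrixPd i (hessianRows ψ j) u)ᵀ))
        (μ⁻¹ * matrixPd i (hessianRows ψ j) u) 0 := fun i j => by
    rw [← matrixPd_const_mul _ (hd j), show (matrixPd i (hessianRows ψ j) u)ᵀ =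
      matrixPd i (fun v => (hessianRows ψ j v)ᵀ) u from rfl,
      ← matrixPd_const_mul (F := fun v => (hessianRows ψ j v)ᵀ) _ (fun k l => hd j l k)]
    ext c d
    rcases c with c | c <;> rcases d with d | d
    · exact pd_const _ _
    · simp [matrixPd, gaussWeingarten, pd]
    · rfl
    · exact pd_const _ _
  rw [key, key, hW]

/-- The product of two off-diagonal blocks is block diagonal. Symmetry in i, j of the upper left
block is (G), that of the lower right block is (R). -/
theorem gaussWeingarten_comm (hU : IsOpen U) (hμ : μ.IsSymm)
    (hψ : IsSolution U η μ ψ) (hu : u ∈ U)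
    (i j : Fin N) : gaussWeingarten η μ ψ i u * gaussWeingarten η μ ψ j u =
      gaussWeingarten η μ ψ j u * gaussWeingarten η μ ψ i u := by
  have hμ' : ∀ α β, μ⁻¹ α β = μ⁻¹ β α := fun α β => by
    conv_lhs => rw [← hμ.eq, ← transpose_nonsing_inv]
    rfl
  have h1 : (hessianRows ψ i u)ᵀ * (μ⁻¹ * hessianRows ψ j u) =
      (hessianRows ψ j u)ᵀ * (μ⁻¹ * hessianRows ψ i u) := by
    ext k l
    have h := hψ.gauss u hu i j k l
    simp_rw [mul_sub, Finset.sum_sub_distrib] at h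
    simp only [mul_apply, transpose_apply, hessianRows, of_apply, Finset.mul_sum]
    rw [sub_eq_zero] at h
    calc _ = _ := Finset.sum_congr rfl fun α _ => Finset.sum_congr rfl fun β _ => by ring
      _ = _ := h
      _ = _ := Finset.sum_comm
      _ = _ := Finset.sum_congr rfl fun α _ => Finset.sum_congr rfl fun β _ => by
        rw [hμ' β α]; ring
  have h2 : hessianRows ψ i u * (η⁻¹ * (hessianRows ψ j u)ᵀ) =
      hessianRows ψ j u * (η⁻¹ * (hessianRows ψ i u)ᵀ) := by
    ext α β
    have h := hψ.ricci u hu α β i j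
    simp_rw [mul_sub, Finset.sum_sub_distrib] at h
    simp only [mul_apply, transpose_apply, hessianRows, of_apply, Finset.mul_sum]
    rw [sub_eq_zero] at h
    simp_rw [hessian_symm hU (hψ.smooth _) hu i, hessian_symm hU (hψ.smooth _) hu j]
    calc _ = _ := Finset.sum_congr rfl fun k _ => Finset.sum_congr rfl fun l _ => by ring
      _ = _ := h
      _ = _ := Finset.sum_congr rfl fun k _ => Finset.sum_congr rfl fun l _ => by ring
  have key : ∀ i j, gaussWeingarten η μ ψ i u * gaussWeingarten η μ ψ j u =
      fromBlocks (-(η⁻¹ * ((hessianRows ψ i u)ᵀ * (μ⁻¹ * hessianRows ψ j u)))) 0 0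
        (-(μ⁻¹ * (hessianRows ψ i u * (η⁻¹ * (hessianRows ψ j u)ᵀ)))) := fun i j => by
    rw [gaussWeingarten, gaussWeingarten, fromBlocks_multiply]
    simp [Matrix.mul_assoc]
  rw [key, key, h1, h2]

/-- The moving frame of a realization solves the Gauss–Weingarten equations. -/
theorem matrixPd_frameMatrix (hpq : p + q = N + L) (hU : IsOpen U) (hηd : η.det ≠ 0)
    (hμd : μ.det ≠ 0) (h : Realizes U η μ ψ r n) (hu : u ∈ U) (i : Fin N) :
    matrixPd i (frameMatrix r n) u = frameMatrix r n u * gaussWeingarten η μ ψ i u := by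
  have hr := h.flatTorsionless.1.smooth
  ext a c
  rcases c with j | α
  · have h1 := pd_pd_eq hU hr hpq h.flatCoordinates hηd hμd h.frame hu i j
    have h2 := pd_apply (differentiableAt_of_contDiffOn hU (contDiffOn_pd hU hr j) hu) i a
    refine h2.trans ?_
    rw [h1, mul_apply, Fintype.sum_sum_type]
    simp only [h.secondForm_eq u hu]
    simp [gaussWeingarten, frameMatrix, mul_apply, hessianRows, mul_comm]
  · have h1 := pd_normal_eq hU hr hpq h.flatCoordinates hηd hμd h.frame hu α i
    have h2 := pd_apply (differentiableAt_of_contDiffOn hU (h.frame.1.smooth α) hu) i a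
    refine h2.trans ?_
    rw [h1, mul_apply, Fintype.sum_sum_type]
    simp only [h.secondForm_eq u hu]
    simp [gaussWeingarten, frameMatrix, mul_apply, hessianRows, mul_comm]

theorem contDiffOn_frameMatrix (hU : IsOpen U) (hr : ContDiffOn ℝ ∞ r U)
    (hn : ∀ α, ContDiffOn ℝ ∞ (n α) U) (a : Fin p ⊕ Fin q) (c : Fin N ⊕ Fin L) :
    ContDiffOn ℝ ∞ (fun v => frameMatrix r n v a c) U := by
  rcases c with j | α
  · exact contDiffOn_pi.1 (contDiffOn_pd hU hr j) a
  · exact contDiffOn_pi.1 (hn α) a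

theorem matrixPd_const {κ ι : Type*} (C : Matrix κ ι ℝ) (i : Fin N) :
    matrixPd i (fun _ : Fin N → ℝ => C) u = 0 := by
  ext k l
  exact pd_const _ _

/-- Solutions of the Gauss–Weingarten equations are congruent. -/
theorem gaussWeingarten_const (hU : IsOpen U) (hUc : IsPreconnected U) (hη : η.IsSymm)
    (hμ : μ.IsSymm) {κ κ' : Type*} {F : (Fin N → ℝ) → Matrix κ (Fin N ⊕ Fin L) ℝ}
    {F' : (Fin N → ℝ) → Matrix κ' (Fin N ⊕ Fin L) ℝ}
    (hFs : ∀ k l, ContDiffOn ℝ ∞ (fun v => F v k l) U)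
    (hF's : ∀ k l, ContDiffOn ℝ ∞ (fun v => F' v k l) U)
    (hF : ∀ u ∈ U, ∀ i, matrixPd i F u = F u * gaussWeingarten η μ ψ i u)
    (hF' : ∀ u ∈ U, ∀ i, matrixPd i F' u = F' u * gaussWeingarten η μ ψ i u)
    {v w : Fin N → ℝ} (hv : v ∈ U) (hw : w ∈ U) :
    F' v * fromBlocks η⁻¹ 0 0 μ⁻¹ * (F v)ᵀ = F' w * fromBlocks η⁻¹ 0 0 μ⁻¹ * (F w)ᵀ :=
  mul_mul_transpose_const (S := fun _ => fromBlocks η⁻¹ 0 0 μ⁻¹) hU hUc hFs hF's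
    (fun _ _ => contDiffOn_const) hF hF'
    (fun u _ i => by rw [matrixPd_const, gaussWeingarten_metric hη hμ, neg_zero]) hv hw

theorem pseudoInner_mulVec {A : Matrix (Fin p ⊕ Fin q) (Fin p ⊕ Fin q) ℝ}
    (hA : Aᵀ * diagonal (signWeights p q) * A = diagonal (signWeights p q))
    (x y : PseudoEuclidean p q) : pseudoInner (A *ᵥ x) (A *ᵥ y) = pseudoInner x y := by
  have h : ∀ x y : PseudoEuclidean p q,
      pseudoInner x y = x ⬝ᵥ (diagonal (signWeights p q) *ᵥ y) := fun x y => by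
    rw [pseudoInner_eq, dotProduct]
    refine Finset.sum_congr rfl fun a _ => ?_
    rw [mulVec_diagonal]; ring
  have e := dotProduct_mulVec x Aᵀ (diagonal (signWeights p q) *ᵥ A *ᵥ y)
  rw [vecMul_transpose, mulVec_mulVec, mulVec_mulVec, hA] at e
  rw [h, h, e]

/-- Two realizations of the same data differ by a motion. -/
theorem exists_motion (hpq : p + q = N + L) (hU : IsOpen U) (hUc : IsPreconnected U)
    (hUne : U.Nonempty) (hη : IsMetricMatrix η) (hμ : IsMetricMatrix μ)
    (h : Realizes U η μ ψ r n) {r' : (Fin N → ℝ) → PseudoEuclidean p q}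
    {n' : Fin L → (Fin N → ℝ) → PseudoEuclidean p q} (h' : Realizes U η μ ψ r' n') :
    ∃ (A : PseudoEuclidean p q ≃ₗ[ℝ] PseudoEuclidean p q) (b : PseudoEuclidean p q),
      (∀ x y, pseudoInner (A x) (A y) = pseudoInner x y) ∧
      ∀ u ∈ U, r' u = A (r u) + b ∧ ∀ α, n' α u = A (n α u) := by
  obtain ⟨x, hx⟩ := hUne
  set J := diagonal (signWeights p q) with hJ
  set S := fromBlocks η⁻¹ (0 : Matrix (Fin N) (Fin L) ℝ) 0 μ⁻¹ with hS
  have hr := h.flatTorsionless.1.smooth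
  have hr' := h'.flatTorsionless.1.smooth
  set F := frameMatrix r n
  set F' := frameMatrix r' n'
  have hFs := contDiffOn_frameMatrix hU hr h.frame.1.smooth
  have hF's := contDiffOn_frameMatrix hU hr' h'.frame.1.smooth
  have hF := fun u (hu : u ∈ U) i => matrixPd_frameMatrix hpq hU hη.2 hμ.2 h hu i
  have hF' := fun u (hu : u ∈ U) i => matrixPd_frameMatrix hpq hU hη.2 hμ.2 h' hu i
  have hG := fun u (hu : u ∈ U) => frameMatrix_gram (h.flatCoordinates u hu) h.frame.1 hu
  have hG' := fun u (hu : u ∈ U) => frameMatrix_gram (h'.flatCoordinates u hu) h'.frame.1 hu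
  have hli := fun u hu => gram_left_inverse hη.2 hμ.2 (hG u hu)
  have hli' := fun u hu => gram_left_inverse hη.2 hμ.2 (hG' u hu)
  have hri := fun u hu => gram_right_inverse hpq hη.2 hμ.2 (hG u hu)
  -- S Fᵀ J is the inverse of F, so B = F'(x) F(x)⁻¹ is the only candidate for the linear part of
  -- the motion.
  set B := F' x * S * (F x)ᵀ * J with hB
  set C := F x * S * (F' x)ᵀ * J with hC
  -- Since F' S Fᵀ is constant, the base point x in B may be replaced by any u.
  have hBF : ∀ u ∈ U, B * F u = F' u := fun u hu => by
    rw [hB, gaussWeingarten_const hU hUc hη.1 hμ.1 hFs hF's hF hF' hx hu]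
    have := hli u hu
    simp only [Matrix.mul_assoc] at this ⊢
    rw [this, Matrix.mul_one]
  have hCF : C * F' x = F x := by
    have := hli' x hx
    simp only [hC, Matrix.mul_assoc] at this ⊢
    rw [this, Matrix.mul_one]
  have hCB : C * B = 1 := by
    rw [hB, ← Matrix.mul_assoc, ← Matrix.mul_assoc, ← Matrix.mul_assoc, hCF, hri x hx]
  have hBC : B * C = 1 := mul_eq_one_comm.1 hCB
  -- B maps the frame at x to one with the same Gram matrix; cancelling F(x) on both sides shows
  -- that B preserves the form.
  have hBJ : Bᵀ * J * B = J := by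
    have e1 : F x * (S * (F x)ᵀ * J) = 1 := by
      simpa only [Matrix.mul_assoc] using hri x hx
    have e2 : (F x)ᵀ * (Bᵀ * J * B) * F x = (F x)ᵀ * J * F x := by
      have : (F x)ᵀ * (Bᵀ * J * B) * F x = (B * F x)ᵀ * J * (B * F x) := by
        simp only [transpose_mul, Matrix.mul_assoc]
      rw [this, hBF x hx, hG' x hx, hG x hx]
    have e3 : ∀ Z : Matrix (Fin p ⊕ Fin q) (Fin p ⊕ Fin q) ℝ,
        (S * (F x)ᵀ * J)ᵀ * ((F x)ᵀ * Z * F x) * (S * (F x)ᵀ * J) = Z := fun Z => by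
      have : (S * (F x)ᵀ * J)ᵀ * ((F x)ᵀ * Z * F x) * (S * (F x)ᵀ * J) =
        (F x * (S * (F x)ᵀ * J))ᵀ * Z * (F x * (S * (F x)ᵀ * J)) := by
        rw [transpose_mul (F x)]
        simp only [Matrix.mul_assoc]
      rw [this, e1]
      simp
    rw [← e3 (Bᵀ * J * B), e2, e3]
  let A : PseudoEuclidean p q ≃ₗ[ℝ] PseudoEuclidean p q := LinearEquiv.ofLinearMap (toLin' B)
    (toLin' C) (by rw [← toLin'_mul, hBC, toLin'_one]) (by rw [← toLin'_mul, hCB, toLin'_one])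
  have hA : ∀ y, A y = B *ᵥ y := fun y => rfl
  have hcol : ∀ u ∈ U, ∀ c, (F' u).col c = A ((F u).col c) := fun u hu c => by
    rw [hA, ← hBF u hu]
    ext a
    simp [mul_apply, mulVec, dotProduct]
  refine ⟨A, r' x - A (r x), pseudoInner_mulVec hBJ, fun u hu => ⟨?_, fun α => hcol u hu (Sum.inr α)⟩⟩
  have hAL : ∀ y, A y = A.toLinearMap.toContinuousLinearMap y := fun y => rfl
  have := eqOn_const_of_pd_eq_zero hU hUc (f := fun v => r' v - A (r v)) ?_
    (fun v hv i => ?_) hu hx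
  · rw [← this]; abel
  · simp_rw [hAL]
    exact hr'.sub ((ContinuousLinearMap.contDiff _).comp_contDiffOn hr)
  · have dr := differentiableAt_of_contDiffOn hU hr hv
    simp_rw [hAL]
    rw [pd_sub (differentiableAt_of_contDiffOn hU hr' hv)
      ((ContinuousLinearMap.differentiableAt _).fun_comp' v dr), pd_clm_comp _ dr, ← hAL]
    exact sub_eq_zero.2 (hcol v hv (Sum.inl i))

theorem isFlatMetric_of_const (hU : IsOpen U) {g : (Fin N → ℝ) → Matrix (Fin N) (Fin N) ℝ}
    (hg : ∀ u ∈ U, g u = η) : IsFlatMetric U g := by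
  have h0 : ∀ k i j, ∀ u ∈ U, christoffel g k i j u = 0 := fun k i j u hu => by
    have : ∀ i s j, pd i (fun v => g v s j) u = 0 := fun i s j => by
      rw [pd_congr hU (g := fun _ => η s j) (fun v hv => by simp only [hg v hv]) hu, pd_const]
    simp [christoffel, this]
  intro u hu l k i j
  have h1 : ∀ l i j k, pd i (christoffel g l j k) u = 0 := fun l i j k => by
    rw [pd_congr hU (h0 l j k) hu, pd_const]
  simp [riemann, h1, h0 _ _ _ u hu]

theorem isTorsionlessFrame_of_gram (hpq : p + q = N + L) (hηd : η.det ≠ 0) (hμd : μ.det ≠ 0)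
    (hn : ∀ α, ContDiffOn ℝ ∞ (n α) U)
    (hG : ∀ u ∈ U, (frameMatrix r n u)ᵀ * diagonal (signWeights p q) * frameMatrix r n u =
      fromBlocks η 0 0 μ) (ht : ∀ u ∈ U, ∀ α β i, torsionForm n α β i u = 0) :
    IsTorsionlessFrame U r μ n := by
  refine ⟨⟨hn, fun u hu => (gram_eq_iff.1 (hG u hu)).2.1, fun u hu => ?_, fun u hu x hx => ?_,
    fun u hu => (gram_eq_iff.1 (hG u hu)).2.2⟩, ht⟩
  · exact (linearIndependent_of_gram hηd hμd (hG u hu)).comp _ Sum.inr_injective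
  · rw [eq_sum_of_gram hpq hηd hμd (hG u hu) x]
    simp only [frameMatrix_col_inl, frameMatrix_col_inr, hx, mul_zero, Finset.sum_const_zero,
      zero_smul, zero_add]
    exact Submodule.sum_mem _ fun α _ =>
      Submodule.smul_mem _ _ (Submodule.subset_span (Set.mem_range_self α))

/-- Each solution is realized by a flat torsionless submanifold. -/
theorem exists_realization (hpq : p + q = N + L) (hU : IsOpen U) (hUs : IsSimplyConnected U)
    (hη : IsMetricMatrix η) (hμ : IsMetricMatrix μ) (hsig : (p, q) = signature η + signature μ)
    (hψ : IsSolution U η μ ψ) :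
    ∃ (r : (Fin N → ℝ) → PseudoEuclidean p q) (n : Fin L → (Fin N → ℝ) → PseudoEuclidean p q),
      Realizes U η μ ψ r n := by
  have hUc := hUs.isPathConnected.isConnected.isPreconnected
  obtain ⟨x, hx⟩ := hUs.nonempty
  obtain ⟨P, hP⟩ := exists_gram_eq_block hη hμ hsig
  obtain ⟨Φ, hΦ0, hΦs, -, hΦ⟩ := exists_matrix_solution hU hUs (gaussWeingarten η μ ψ)
    (gaussWeingarten_smooth hU hψ.smooth) (fun u hu i j k l => by
      have := congrFun (congrFun (gaussWeingarten_closed (η := η) (μ := μ) hU hψ.smooth hu i j) k) l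
      rw [gaussWeingarten_comm hU hμ.1 hψ hu i j]
      exact congrArg (· + _) this) hx
  set F : (Fin N → ℝ) → Matrix (Fin p ⊕ Fin q) (Fin N ⊕ Fin L) ℝ := fun u => P * Φ u with hFdef
  have hFs : ∀ k l, ContDiffOn ℝ ∞ (fun v => F v k l) U :=
    contDiffOn_matrix_mul (F := fun _ => P) (fun _ _ => contDiffOn_const) hΦs
  have hF : ∀ u ∈ U, ∀ i, matrixPd i F u = F u * gaussWeingarten η μ ψ i u := fun u hu i => by
    rw [hFdef, matrixPd_const_mul _ fun k l => differentiableAt_of_contDiffOn hU (hΦs k l) hu,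
      show matrixPd i Φ u = Φ u * gaussWeingarten η μ ψ i u from by ext k l; exact hΦ u hu i k l,
      Matrix.mul_assoc]
  -- The completeness relation holds at x, where F x = P, and propagates because F S Fᵀ is constant.
  have hG : ∀ u ∈ U, (F u)ᵀ * diagonal (signWeights p q) * F u = fromBlocks η 0 0 μ :=
    fun u hu => by
      refine gram_of_right_inverse hpq hη.2 hμ.2 ?_
      rw [gaussWeingarten_const hU hUc hη.1 hμ.1 hFs hFs hF hF hu hx]
      have hFx : F x = P := by simp [hFdef, hΦ0]
      rw [hFx, gram_right_inverse hpq hη.2 hμ.2 hP]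
  let w : Fin N → (Fin N → ℝ) → PseudoEuclidean p q := fun j u => (F u).col (Sum.inl j)
  let n : Fin L → (Fin N → ℝ) → PseudoEuclidean p q := fun α u => (F u).col (Sum.inr α)
  have hws : ∀ j, ContDiffOn ℝ ∞ (w j) U := fun j => contDiffOn_pi.2 fun a => hFs a _
  have hns : ∀ α, ContDiffOn ℝ ∞ (n α) U := fun α => contDiffOn_pi.2 fun a => hFs a _
  have hpdw : ∀ u ∈ U, ∀ i j, pd i (w j) u =
      ∑ α, (∑ β, μ⁻¹ α β * hessian (ψ β) u i j) • n α u := fun u hu i j => by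
    ext a
    rw [← pd_apply (differentiableAt_of_contDiffOn hU (hws j) hu)]
    refine (congrFun (congrFun (hF u hu i) a) (Sum.inl j)).trans ?_
    rw [mul_apply, Fintype.sum_sum_type]
    simp [gaussWeingarten, mul_apply, hessianRows, n, mul_comm]
  have hpdn : ∀ u ∈ U, ∀ i α, pd i (n α) u =
      ∑ k, (-∑ j, η⁻¹ k j * hessian (ψ α) u i j) • w k u := fun u hu i α => by
    ext a
    rw [← pd_apply (differentiableAt_of_contDiffOn hU (hns α) hu)]
    refine (congrFun (congrFun (hF u hu i) a) (Sum.inr α)).trans ?_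
    rw [mul_apply, Fintype.sum_sum_type]
    simp [gaussWeingarten, mul_apply, hessianRows, w, mul_comm]
  -- The tangent columns are the derivatives of some r because ∂_i w_j involves i, j only through a
  -- symmetric Hessian.
  obtain ⟨r, hr, hrw⟩ := exists_vector_potential hU hUs w hws fun u hu i j => by
    rw [hpdw u hu, hpdw u hu]
    simp_rw [hessian_symm hU (hψ.smooth _) hu i j]
  have hframe : ∀ u ∈ U, frameMatrix r n u = F u := fun u hu => by
    ext a c
    rcases c with j | α
    · exact congrFun (hrw u hu j) a
    · rfl
  have hG' : ∀ u ∈ U, (frameMatrix r n u)ᵀ * diagonal (signWeights p q) * frameMatrix r n u =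
      fromBlocks η 0 0 μ := fun u hu => by rw [hframe u hu, hG u hu]
  have hfc : IsFlatCoordinates U r η := fun u hu => by
    ext i j
    exact (gram_eq_iff.1 (hG' u hu)).1 i j
  have hnw : ∀ u ∈ U, ∀ α i, pseudoInner (n α u) (w i u) = 0 := fun u hu =>
    (gram_eq_iff.1 (hG u hu)).2.1
  have hnn : ∀ u ∈ U, ∀ α β, pseudoInner (n α u) (n β u) = μ α β := fun u hu =>
    (gram_eq_iff.1 (hG u hu)).2.2
  have htf : IsTorsionlessFrame U r μ n :=
    isTorsionlessFrame_of_gram hpq hη.2 hμ.2 hns hG' fun u hu α β i => by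
      rw [torsionForm, hpdn u hu, pseudoInner_sum_left]
      simp_rw [pseudoInner_comm (w _ u), hnw u hu]
      simp
  refine ⟨r, n, ⟨⟨hr, fun u hu => ?_, fun u hu => ?_⟩, isFlatMetric_of_const hU hfc,
    μ, n, htf⟩, hfc, htf, fun u hu α => ?_⟩
  · exact (linearIndependent_of_gram hη.2 hμ.2 (hG' u hu)).comp _ Sum.inl_injective
  · rw [hfc u hu]; exact hη.2
  · ext i j
    simp only [secondForm, of_apply]
    rw [pd_congr hU (fun v hv => hrw v hv j) hu, hpdw u hu, pseudoInner_sum_right]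
    simp_rw [hnn u hu]
    have : ∀ γ, ∑ β, (∑ δ, μ⁻¹ β δ * hessian (ψ δ) u i j) * μ γ β = hessian (ψ γ) u i j := by
      intro γ
      have h1 : (μ *ᵥ (μ⁻¹ *ᵥ fun δ => hessian (ψ δ) u i j)) γ = hessian (ψ γ) u i j := by
        rw [mulVec_mulVec, mul_nonsing_inv _ hμ.2.isUnit, one_mulVec]
      rw [← h1]
      simp [mulVec, dotProduct, mul_comm]
    exact this α

end GaussWeingarten

/-! ### Flat coordinates for a metric of zero curvature. -/

section FlatMetric

variable {N : ℕ} {U : Set (Fin N → ℝ)} {u : Fin N → ℝ}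
  {g : (Fin N → ℝ) → Matrix (Fin N) (Fin N) ℝ}

theorem contDiffOn_det {ι : Type*} [Fintype ι] [DecidableEq ι]
    {A : (Fin N → ℝ) → Matrix ι ι ℝ} (hA : ∀ k l, ContDiffOn ℝ ∞ (fun u => A u k l) U) :
    ContDiffOn ℝ ∞ (fun u => (A u).det) U := by
  simp only [det_apply']
  exact ContDiffOn.sum fun σ _ => contDiffOn_const.mul (contDiffOn_prod fun i _ => hA _ _)

theorem contDiffOn_inv {ι : Type*} [Fintype ι] [DecidableEq ι]
    {A : (Fin N → ℝ) → Matrix ι ι ℝ} (hA : ∀ k l, ContDiffOn ℝ ∞ (fun u => A u k l) U)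
    (hdet : ∀ u ∈ U, (A u).det ≠ 0) (k l : ι) : ContDiffOn ℝ ∞ (fun u => (A u)⁻¹ k l) U := by
  simp only [inv_def, Matrix.smul_apply, Ring.inverse_eq_inv', adjugate_apply, smul_eq_mul]
  refine ((contDiffOn_det hA).inv hdet).mul (contDiffOn_det fun i j => ?_)
  by_cases h : i = l
  · subst h
    simpa using contDiffOn_const
  · simpa [updateRow_ne h] using hA i j

/-- The connection matrices of the Levi-Civita connection. -/
noncomputable def connectionMatrix (g : (Fin N → ℝ) → Matrix (Fin N) (Fin N) ℝ) (i : Fin N)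
    (u : Fin N → ℝ) : Matrix (Fin N) (Fin N) ℝ :=
  of fun k j => christoffel g k i j u

theorem contDiffOn_christoffel (hU : IsOpen U) (hg : ∀ k l, ContDiffOn ℝ ∞ (fun u => g u k l) U)
    (hdet : ∀ u ∈ U, (g u).det ≠ 0) (k i j : Fin N) : ContDiffOn ℝ ∞ (christoffel g k i j) U := by
  unfold christoffel
  exact contDiffOn_const.mul (ContDiffOn.sum fun s _ => (contDiffOn_inv hg hdet k s).mul
    (((contDiffOn_pd hU (hg s j) i).add (contDiffOn_pd hU (hg i s) j)).sub
      (contDiffOn_pd hU (hg i j) s)))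

theorem christoffel_symm (hsymm : ∀ u, (g u).IsSymm) (k i j : Fin N) :
    christoffel g k i j u = christoffel g k j i u := by
  have h : ∀ s t, (fun v => g v s t) = fun v => g v t s := fun s t => by
    funext v
    exact (hsymm v).apply t s
  unfold christoffel
  congr 1
  refine Finset.sum_congr rfl fun s _ => ?_
  rw [h j i, h i s, h s j]
  ring

/-- The Levi-Civita connection is metric. -/
theorem matrixPd_metric (hsymm : ∀ u, (g u).IsSymm) (hdet : (g u).det ≠ 0) (i : Fin N) :
    matrixPd i g u = g u * connectionMatrix g i u + (connectionMatrix g i u)ᵀ * g u := by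
  have h : ∀ s t, (fun v => g v s t) = fun v => g v t s := fun s t => by
    funext v
    exact (hsymm v).apply t s
  have h1 : ∀ l j, (g u * connectionMatrix g i u) l j = (1 / 2) *
      (pd i (fun v => g v l j) u + pd j (fun v => g v i l) u - pd l (fun v => g v i j) u) := by
    intro l j
    have h2 : (fun k => connectionMatrix g i u k j) = (1 / 2 : ℝ) • ((g u)⁻¹ *ᵥ fun s =>
        (pd i (fun v => g v s j) u + pd j (fun v => g v i s) u - pd s (fun v => g v i j) u)) := by
      ext k
      simp [connectionMatrix, christoffel, mulVec, dotProduct]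
    have h3 : (g u * connectionMatrix g i u) l j =
      (g u *ᵥ fun k => connectionMatrix g i u k j) l := rfl
    rw [h3, h2, mulVec_smul, mulVec_mulVec, mul_nonsing_inv _ hdet.isUnit, one_mulVec]
    rfl
  have h4 : (connectionMatrix g i u)ᵀ * g u = (g u * connectionMatrix g i u)ᵀ := by
    rw [transpose_mul, (hsymm u).eq]
  ext l j
  rw [h4, Matrix.add_apply, transpose_apply, h1, h1, h j l, h i l, h i j]
  simp only [matrixPd, of_apply]
  ring

/-- Obtained by differentiating g g⁻¹ = 1. It is the equation that `mul_mul_transpose_const`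
requires of S, here for S = g⁻¹. -/
theorem matrixPd_inv_metric (hU : IsOpen U) (hg : ∀ k l, ContDiffOn ℝ ∞ (fun u => g u k l) U)
    (hsymm : ∀ u, (g u).IsSymm) (hdet : ∀ u ∈ U, (g u).det ≠ 0) (hu : u ∈ U) (i : Fin N) :
    matrixPd i (fun v => (g v)⁻¹) u =
      -(connectionMatrix g i u * (g u)⁻¹ + (g u)⁻¹ * (connectionMatrix g i u)ᵀ) := by
  have hunit := (hdet u hu).isUnit
  have h1 : matrixPd i (fun v => g v * (g v)⁻¹) u = 0 := by
    ext k l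
    simp only [matrixPd, of_apply, Matrix.zero_apply]
    rw [pd_congr hU (g := fun _ => (1 : Matrix (Fin N) (Fin N) ℝ) k l)
      (fun v hv => by simp only [mul_nonsing_inv _ (hdet v hv).isUnit]) hu, pd_const]
  rw [matrixPd_mul (fun k l => differentiableAt_of_contDiffOn hU (hg k l) hu)
    (fun k l => differentiableAt_of_contDiffOn hU (contDiffOn_inv hg hdet k l) hu),
    matrixPd_metric hsymm (hdet u hu)] at h1
  have h2 := congrArg ((g u)⁻¹ * ·) h1
  simp only [Matrix.mul_zero, Matrix.mul_add, Matrix.add_mul, ← Matrix.mul_assoc,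
    nonsing_inv_mul _ hunit, Matrix.one_mul] at h2
  rw [Matrix.mul_assoc _ (g u) (g u)⁻¹, mul_nonsing_inv _ hunit, Matrix.mul_one] at h2
  rw [eq_neg_iff_add_eq_zero, add_comm]
  exact h2

theorem isSimplyConnected_ball {E : Type*} [NormedAddCommGroup E] [NormedSpace ℝ E] (x : E) {δ : ℝ}
    (hδ : 0 < δ) : IsSimplyConnected (ball x δ) := by
  have : ContractibleSpace (ball x δ) := (convex_ball x δ).contractibleSpace (nonempty_ball.2 hδ)
  exact SimplyConnectedSpace.ofContractible _

/-- The Jacobi matrix of a map. -/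
noncomputable def jacobian (φ : (Fin N → ℝ) → Fin N → ℝ) (v : Fin N → ℝ) :
    Matrix (Fin N) (Fin N) ℝ :=
  of fun i a => pd a φ v i

theorem pd_comp {E : Type*} [NormedAddCommGroup E] [NormedSpace ℝ E] {f : (Fin N → ℝ) → E}
    {φ : (Fin N → ℝ) → Fin N → ℝ} {v : Fin N → ℝ} (hf : DifferentiableAt ℝ f (φ v))
    (hφ : DifferentiableAt ℝ φ v) (a : Fin N) :
    pd a (f ∘ φ) v = ∑ i, jacobian φ v i a • pd i f (φ v) := by
  rw [pd, (hf.hasFDerivAt.comp v hφ.hasFDerivAt).fderiv, ContinuousLinearMap.comp_apply,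
    fderiv_apply_eq_sum_pd]
  rfl

/-- A map with invertible Jacobi matrix is near a point the inverse of a parametrization by a
ball. -/
theorem exists_inverse_chart {B : Set (Fin N → ℝ)} (hB : IsOpen B) {y : (Fin N → ℝ) → Fin N → ℝ}
    (hy : ContDiffOn ℝ ∞ y B) (hJ : ∀ u ∈ B, IsUnit (jacobian y u)) {u₀ : Fin N → ℝ}
    (hu₀ : u₀ ∈ B) :
    ∃ φ : OpenPartialHomeomorph (Fin N → ℝ) (Fin N → ℝ), u₀ ∈ φ.target ∧ φ.target ⊆ B ∧
      IsSimplyConnected φ.source ∧ ContDiffOn ℝ ∞ φ φ.source ∧ ContDiffOn ℝ ∞ φ.symm φ.target ∧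
      ∀ v ∈ φ.source, jacobian y (φ v) * jacobian φ v = 1 := by
  have hyat : ∀ u ∈ B, ContDiffAt ℝ ∞ y u := fun u hu => hy.contDiffAt (hB.mem_nhds hu)
  have hder : ∀ u ∈ B, ∃ T : (Fin N → ℝ) ≃L[ℝ] (Fin N → ℝ),
      HasFDerivAt y (T : (Fin N → ℝ) →L[ℝ] (Fin N → ℝ)) u := fun u hu => by
    have hdet := (isUnit_iff_isUnit_det _).1 (hJ u hu)
    let e : (Fin N → ℝ) ≃ₗ[ℝ] (Fin N → ℝ) := LinearEquiv.ofLinearMap (toLin' (jacobian y u))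
      (toLin' (jacobian y u)⁻¹) (by rw [← toLin'_mul, mul_nonsing_inv _ hdet, toLin'_one])
      (by rw [← toLin'_mul, nonsing_inv_mul _ hdet, toLin'_one])
    refine ⟨e.toContinuousLinearEquiv,
      ((hyat u hu).differentiableAt (by simp)).hasFDerivAt.congr_fderiv ?_⟩
    ext1 h
    rw [fderiv_apply_eq_sum_pd]
    change _ = jacobian y u *ᵥ h
    ext a
    simp [jacobian, mulVec, dotProduct, mul_comm]
  obtain ⟨T, hT⟩ := hder u₀ hu₀
  let h := ((hyat u₀ hu₀).toOpenPartialHomeomorph y hT (by simp)).restrOpen B hB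
  have hu₀h : u₀ ∈ h.source :=
    ⟨(hyat u₀ hu₀).mem_toOpenPartialHomeomorph_source hT (by simp), hu₀⟩
  have hsB : h.source ⊆ B := fun v hv => hv.2
  obtain ⟨ε, hε, hD⟩ := Metric.isOpen_iff.1 h.open_target (h u₀) (h.map_source hu₀h)
  -- Cutting the inverse down to a ball in the new coordinates makes its domain simply connected.
  let φ := h.symm.restrOpen (ball (h u₀) ε) isOpen_ball
  have hsource : φ.source = ball (h u₀) ε := inter_eq_right.2 hD
  have hmap : ∀ v ∈ φ.source, h.symm v ∈ B := fun v hv => hsB (h.map_target hv.1)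
  have htarget : φ.target ⊆ B := fun v hv => by
    rw [← φ.right_inv hv]
    exact hmap _ (φ.map_target hv)
  have hsm : ∀ v ∈ φ.source, ContDiffAt ℝ ∞ h.symm v := fun v hv => by
    obtain ⟨T, hT⟩ := hder _ (hmap v hv)
    exact h.contDiffAt_symm hv.1 hT (hyat _ (hmap v hv))
  refine ⟨φ, ?_, htarget, ?_, fun v hv => (hsm v hv).contDiffWithinAt, hy.mono htarget,
    fun v hv => ?_⟩
  · have : φ (h u₀) ∈ φ.target := φ.map_source (by rw [hsource]; exact mem_ball_self hε)
    rwa [show φ (h u₀) = u₀ from h.left_inv hu₀h] at this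
  · rw [hsource]
    exact isSimplyConnected_ball _ hε
  · ext a b
    have h1 := pd_comp (f := y) (φ := φ) (v := v) ((hyat _ (hmap v hv)).differentiableAt (by simp))
      ((hsm v hv).differentiableAt (by simp)) b
    rw [pd_congr φ.open_source (f := y ∘ φ) (g := fun w => w) (fun w hw => h.right_inv hw.1) hv] at h1
    have h2 := congrFun h1 a
    have h3 : pd b (fun w : Fin N → ℝ => w) v = Pi.single b 1 := by simp [pd]
    rw [h3] at h2
    rw [mul_apply, one_apply, ← Pi.single_apply, h2]
    simp [jacobian, mul_comm]

/-- A flat metric has constant coefficients in suitable coordinates near each point. -/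
theorem exists_flat_coordinates (hU : IsOpen U) (hg : ∀ k l, ContDiffOn ℝ ∞ (fun u => g u k l) U)
    (hsymm : ∀ u, (g u).IsSymm) (hdet : ∀ u ∈ U, (g u).det ≠ 0) (hflat : IsFlatMetric U g)
    {u₀ : Fin N → ℝ} (hu₀ : u₀ ∈ U) :
    ∃ φ : OpenPartialHomeomorph (Fin N → ℝ) (Fin N → ℝ), u₀ ∈ φ.target ∧ φ.target ⊆ U ∧
      IsSimplyConnected φ.source ∧ ContDiffOn ℝ ∞ φ φ.source ∧ ContDiffOn ℝ ∞ φ.symm φ.target ∧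
      ∀ v ∈ φ.source, IsUnit (jacobian φ v) ∧
        (jacobian φ v)ᵀ * g (φ v) * jacobian φ v = g u₀ := by
  obtain ⟨δ, hδ, hBU⟩ := Metric.isOpen_iff.1 hU u₀ hu₀
  set B := ball u₀ δ
  have hB : IsOpen B := isOpen_ball
  have hBs : IsSimplyConnected B := isSimplyConnected_ball u₀ hδ
  have hu₀B : u₀ ∈ B := mem_ball_self hδ
  have hgB : ∀ k l, ContDiffOn ℝ ∞ (fun u => g u k l) B := fun k l => (hg k l).mono hBU
  have hdetB : ∀ u ∈ B, (g u).det ≠ 0 := fun u hu => hdet u (hBU hu)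
  -- The rows of F are parallel covector fields; the vanishing of the Riemann tensor is the flatness
  -- condition of this system.
  obtain ⟨F, hF0, hFs, hFu, hF⟩ := exists_matrix_solution hB hBs (connectionMatrix g)
    (fun i k l => contDiffOn_christoffel hB hgB hdetB k i l) (fun u hu i j k l => by
      have := hflat u (hBU hu) k l i j
      rw [riemann, Finset.sum_sub_distrib] at this
      simp only [mul_apply, connectionMatrix, of_apply]
      have e : ∀ i k l, (fun v => christoffel g k i l v) = christoffel g k i l := fun _ _ _ => rfl
      simp only [e]
      linarith) hu₀B
  have hF' : ∀ u ∈ B, ∀ i, matrixPd i F u = F u * connectionMatrix g i u := fun u hu i => by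
    ext k l
    exact hF u hu i k l
  -- Symmetry of the Christoffel symbols makes the parallel covectors closed; their potentials y are
  -- the flat coordinates.
  obtain ⟨y, hy, hyF⟩ := exists_vector_potential hB hBs (fun i u => (F u).col i)
    (fun i => contDiffOn_pi.2 fun a => hFs a i) (fun u hu i j => by
      have e : ∀ i j, pd i (fun u => (F u).col j) u =
          (F u * connectionMatrix g i u).col j := fun i j => by
        ext a
        rw [← pd_apply (f := fun u => (F u).col j) (differentiableAt_of_contDiffOn hB
          (contDiffOn_pi.2 fun a => hFs a j) hu)]
        exact hF u hu i a j
      rw [e, e]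
      ext a
      simp only [col_apply, mul_apply, connectionMatrix, of_apply, christoffel_symm hsymm _ i j])
  have hyJ : ∀ u ∈ B, jacobian y u = F u := fun u hu => by
    ext a i
    exact congrFun (hyF u hu i) a
  obtain ⟨φ, h1, h2, h3, h4, h5, h6⟩ := exists_inverse_chart hB hy
    (fun u hu => by rw [hyJ u hu]; exact hFu u) hu₀B
  refine ⟨φ, h1, h2.trans hBU, h3, h4, h5, fun v hv => ?_⟩
  have hvB : φ v ∈ B := h2 (φ.map_source hv)
  have hFP := h6 v hv
  rw [hyJ _ hvB] at hFP
  refine ⟨(isUnit_iff_isUnit_det _).2 (isUnit_det_of_left_inverse hFP), ?_⟩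
  set P := jacobian φ v
  -- F g⁻¹ Fᵀ is constant and F(u₀) = 1. As P = F⁻¹, inverting this identity gives Pᵀ g P = g(u₀).
  have hconst : F (φ v) * (g (φ v))⁻¹ * (F (φ v))ᵀ = (g u₀)⁻¹ := by
    have := mul_mul_transpose_const hB hBs.isPathConnected.isConnected.isPreconnected hFs hFs
      (contDiffOn_inv hgB hdetB) hF' hF'
      (fun u hu i => matrixPd_inv_metric hB hgB hsymm hdetB hu i) hvB hu₀B
    rw [this, hF0]
    simp
  have hFPt : (F (φ v))ᵀ * Pᵀ = 1 := by
    rw [← transpose_mul, mul_eq_one_comm.1 hFP, transpose_one]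
  have hprod : (g u₀)⁻¹ * (Pᵀ * g (φ v) * P) = 1 := by
    rw [← hconst]
    calc _ = F (φ v) * ((g (φ v))⁻¹ * ((F (φ v))ᵀ * Pᵀ) * g (φ v)) * P := by
          simp only [Matrix.mul_assoc]
      _ = 1 := by
          rw [hFPt, Matrix.mul_one, nonsing_inv_mul _ (hdetB _ hvB).isUnit, Matrix.mul_one, hFP]
  have h7 := inv_eq_right_inv hprod
  rw [← h7, nonsing_inv_nonsing_inv _ (hdet u₀ hu₀).isUnit]

end FlatMetric

/-! ### Invariance under changes of coordinates. -/

section Reparametrization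

variable {N L p q : ℕ} {U V : Set (Fin N → ℝ)} {r : (Fin N → ℝ) → PseudoEuclidean p q}
  {n : Fin L → (Fin N → ℝ) → PseudoEuclidean p q} {η : Matrix (Fin N) (Fin N) ℝ}
  {μ : Matrix (Fin L) (Fin L) ℝ} {φ : (Fin N → ℝ) → Fin N → ℝ} {v : Fin N → ℝ}

theorem firstForm_comp (hr : DifferentiableAt ℝ r (φ v)) (hφ : DifferentiableAt ℝ φ v) :
    firstForm (r ∘ φ) v = (jacobian φ v)ᵀ * firstForm r (φ v) * jacobian φ v := by
  ext a b
  simp only [firstForm, of_apply, pd_comp hr hφ, pseudoInner_sum_left, pseudoInner_sum_right,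
    mul_apply, transpose_apply, Finset.mul_sum, Finset.sum_mul]
  exact Finset.sum_congr rfl fun i _ => Finset.sum_congr rfl fun j _ => by ring

theorem linearIndependent_of_firstForm (h : (firstForm r v).det ≠ 0) :
    LinearIndependent ℝ fun i => pd i r v := by
  rw [Fintype.linearIndependent_iff]
  intro c hc
  have : firstForm r v *ᵥ c = 0 := by
    ext j
    have := congrArg (pseudoInner (pd j r v)) hc
    rw [pseudoInner_sum_right, pseudoInner_zero_right] at this
    simpa [mulVec, dotProduct, firstForm, mul_comm] using this
  by_contra hne
  exact h (exists_mulVec_eq_zero_iff.1 ⟨c, fun h0 => hne fun i => congrFun h0 i, this⟩)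

/-- By the chain rule the Jacobi matrix mixes the tangent vectors, and likewise the torsion forms,
linearly. Its invertibility keeps the normal spaces unchanged, and zero torsion stays zero. -/
theorem IsTorsionlessFrame.comp (hU : IsOpen U) (hV : IsOpen V) (hr : ContDiffOn ℝ ∞ r U)
    (hφ : ContDiffOn ℝ ∞ φ V) (hmap : MapsTo φ V U) (hJ : ∀ v ∈ V, IsUnit (jacobian φ v))
    (hn : IsTorsionlessFrame U r μ n) :
    IsTorsionlessFrame V (r ∘ φ) μ fun α => n α ∘ φ := by
  have hdr : ∀ v ∈ V, DifferentiableAt ℝ r (φ v) := fun v hv =>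
    differentiableAt_of_contDiffOn hU hr (hmap hv)
  have hdn : ∀ v ∈ V, ∀ α, DifferentiableAt ℝ (n α) (φ v) := fun v hv α =>
    differentiableAt_of_contDiffOn hU (hn.1.smooth α) (hmap hv)
  have hdφ : ∀ v ∈ V, DifferentiableAt ℝ φ v := fun v hv =>
    differentiableAt_of_contDiffOn hV hφ hv
  refine ⟨⟨fun α => (hn.1.smooth α).comp hφ hmap, fun v hv α a => ?_,
    fun v hv => hn.1.linearIndependent _ (hmap hv), fun v hv x hx => ?_,
    fun v hv => hn.1.gram _ (hmap hv)⟩, fun v hv α β a => ?_⟩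
  · rw [pd_comp (hdr v hv) (hdφ v hv), pseudoInner_sum_right]
    exact Finset.sum_eq_zero fun i _ => by
      rw [Function.comp_apply, hn.1.normal _ (hmap hv), mul_zero]
  · refine hn.1.span _ (hmap hv) x fun i => ?_
    have h1 : (fun i => pseudoInner x (pd i r (φ v))) ᵥ* jacobian φ v = 0 := by
      ext a
      have := hx a
      rw [pd_comp (hdr v hv) (hdφ v hv), pseudoInner_sum_right] at this
      simpa [vecMul, dotProduct, mul_comm] using this
    have h2 := congrArg (· ᵥ* (jacobian φ v)⁻¹) h1
    simp only [vecMul_vecMul, zero_vecMul,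
      mul_nonsing_inv _ ((isUnit_iff_isUnit_det _).1 (hJ v hv)), vecMul_one] at h2
    exact congrFun h2 i
  · rw [torsionForm, pd_comp (hdn v hv α) (hdφ v hv), pseudoInner_sum_left]
    exact Finset.sum_eq_zero fun i _ => by
      have := hn.2 _ (hmap hv) α β i
      rw [torsionForm] at this
      rw [Function.comp_apply, this, mul_zero]

theorem exists_flat_reparametrization (hU : IsOpen U) (hr : IsFlatTorsionless L U r)
    {u₀ : Fin N → ℝ} (hu₀ : u₀ ∈ U) :
    ∃ (φ : OpenPartialHomeomorph (Fin N → ℝ) (Fin N → ℝ)) (η : Matrix (Fin N) (Fin N) ℝ),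
      u₀ ∈ φ.target ∧ φ.target ⊆ U ∧ IsSimplyConnected φ.source ∧
      ContDiffOn ℝ ∞ φ φ.source ∧ ContDiffOn ℝ ∞ φ.symm φ.target ∧
      IsFlatTorsionless L φ.source (r ∘ φ) ∧ IsFlatCoordinates φ.source (r ∘ φ) η := by
  obtain ⟨hr, hflat, μ, n, hn⟩ := hr
  obtain ⟨φ, h1, h2, h3, h4, h5, h6⟩ := exists_flat_coordinates (g := firstForm r) hU
    (fun k l => contDiffOn_pseudoInner (contDiffOn_pd hU hr.smooth k)
      (contDiffOn_pd hU hr.smooth l)) (fun _ => firstForm_isSymm) hr.nonisotropic hflat hu₀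
  have hmap : MapsTo φ φ.source U := fun v hv => h2 (φ.map_source hv)
  have hfc : IsFlatCoordinates φ.source (r ∘ φ) (firstForm r u₀) := fun v hv => by
    rw [firstForm_comp (differentiableAt_of_contDiffOn hU hr.smooth (hmap hv))
      (differentiableAt_of_contDiffOn φ.open_source h4 hv), (h6 v hv).2]
  have hnd : ∀ v ∈ φ.source, (firstForm (r ∘ φ) v).det ≠ 0 := fun v hv => by
    rw [hfc v hv]; exact hr.nonisotropic u₀ hu₀
  exact ⟨φ, firstForm r u₀, h1, h2, h3, h4, h5,
    ⟨⟨hr.smooth.comp h4 hmap, fun v hv => linearIndependent_of_firstForm (hnd v hv), hnd⟩,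
      isFlatMetric_of_const φ.open_source hfc, μ, _,
      hn.comp hU φ.open_source hr.smooth h4 hmap fun v hv => (h6 v hv).1⟩, hfc⟩

end Reparametrization

end FlatTorsionless

theorem mainTheorem6 (N L p q : ℕ) (hpq : p + q = N + L) :
    -- a flat torsionless submanifold admits flat coordinates near each of its points
    (∀ (U : Set (Fin N → ℝ)) (r : (Fin N → ℝ) → FlatTorsionless.PseudoEuclidean p q),
      IsOpen U → FlatTorsionless.IsFlatTorsionless L U r → ∀ u₀ ∈ U,
      ∃ (φ : OpenPartialHomeomorph (Fin N → ℝ) (Fin N → ℝ)) (η : Matrix (Fin N) (Fin N) ℝ),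
        u₀ ∈ φ.target ∧ φ.target ⊆ U ∧ IsSimplyConnected φ.source ∧
        ContDiffOn ℝ ∞ φ φ.source ∧ ContDiffOn ℝ ∞ φ.symm φ.target ∧
        FlatTorsionless.IsFlatTorsionless L φ.source (r ∘ φ) ∧
        FlatTorsionless.IsFlatCoordinates φ.source (r ∘ φ) η) ∧
    -- in flat coordinates, each flat torsionless submanifold comes from a solution
    (∀ (U : Set (Fin N → ℝ)) (r : (Fin N → ℝ) → FlatTorsionless.PseudoEuclidean p q)
      (η : Matrix (Fin N) (Fin N) ℝ) (μ : Matrix (Fin L) (Fin L) ℝ)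
      (n : Fin L → (Fin N → ℝ) → FlatTorsionless.PseudoEuclidean p q),
      IsOpen U → IsSimplyConnected U → FlatTorsionless.IsFlatTorsionless L U r →
      FlatTorsionless.IsFlatCoordinates U r η → FlatTorsionless.IsTorsionlessFrame U r μ n →
      FlatTorsionless.IsMetricMatrix η ∧ FlatTorsionless.IsMetricMatrix μ ∧
      (p, q) = FlatTorsionless.signature η + FlatTorsionless.signature μ ∧
      ∃ ψ : Fin L → (Fin N → ℝ) → ℝ, FlatTorsionless.IsSolution U η μ ψ ∧
        FlatTorsionless.Realizes U η μ ψ r n ∧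
        ∀ ψ' : Fin L → (Fin N → ℝ) → ℝ, (∀ α, ContDiffOn ℝ ∞ (ψ' α) U) →
          (FlatTorsionless.Realizes U η μ ψ' r n ↔
            ∃ (a : Fin L → Fin N → ℝ) (c : Fin L → ℝ), ∀ α, ∀ u ∈ U,
              ψ' α u = ψ α u + ∑ i, a α i * u i + c α)) ∧
    -- each solution comes from a flat torsionless submanifold, unique up to motions
    (∀ (U : Set (Fin N → ℝ)) (η : Matrix (Fin N) (Fin N) ℝ) (μ : Matrix (Fin L) (Fin L) ℝ)
      (ψ : Fin L → (Fin N → ℝ) → ℝ),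
      IsOpen U → IsSimplyConnected U →
      FlatTorsionless.IsMetricMatrix η → FlatTorsionless.IsMetricMatrix μ →
      (p, q) = FlatTorsionless.signature η + FlatTorsionless.signature μ →
      FlatTorsionless.IsSolution U η μ ψ →
      ∃ (r : (Fin N → ℝ) → FlatTorsionless.PseudoEuclidean p q)
        (n : Fin L → (Fin N → ℝ) → FlatTorsionless.PseudoEuclidean p q),
        FlatTorsionless.Realizes U η μ ψ r n ∧
        ∀ (r' : (Fin N → ℝ) → FlatTorsionless.PseudoEuclidean p q)
          (n' : Fin L → (Fin N → ℝ) → FlatTorsionless.PseudoEuclidean p q),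
          FlatTorsionless.Realizes U η μ ψ r' n' →
          ∃ (A : FlatTorsionless.PseudoEuclidean p q ≃ₗ[ℝ] FlatTorsionless.PseudoEuclidean p q)
            (b : FlatTorsionless.PseudoEuclidean p q),
            (∀ x y, FlatTorsionless.pseudoInner (A x) (A y) = FlatTorsionless.pseudoInner x y) ∧
            ∀ u ∈ U, r' u = A (r u) + b ∧ ∀ α, n' α u = A (n α u)) := by
  refine ⟨fun U r hU hr u₀ hu₀ => FlatTorsionless.exists_flat_reparametrization hU hr hu₀,
    fun U r η μ n hU hUs hr hη hn =>
      FlatTorsionless.exists_solution_of_flatTorsionless hpq hU hUs hr hη hn,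
    fun U η μ ψ hU hUs hη hμ hsig hψ => ?_⟩
  obtain ⟨r, n, h⟩ := FlatTorsionless.exists_realization hpq hU hUs hη hμ hsig hψ
  exact ⟨r, n, h, fun r' n' h' => FlatTorsionless.exists_motion hpq hU
    hUs.isPathConnected.isConnected.isPreconnected hUs.nonempty hη hμ h h'⟩
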